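/- Let $(\Omega,\mathfrak F,\mathbb P)$ be a probability space and let $\theta\colon\mathbb R\times\Omega\to\Omega$, $\theta(t,\omega)=\omega\cdot t$, be a jointly measurable, $\mathbb P$-preserving flow, i.e. $\omega\cdot 0=\omega$, $\omega\cdot(s+t)=(\omega\cdot s)\cdot t$, and each map $\omega\mapsto\omega\cdot t$ preserves $\mathbb P$. Assume that it is ergodic: every measurable set $F$ that is invariant under the flow has $\mathbb P(F)\in\{0,1\}$. Let $N\ge 1$ and let $A=(a_{jk})\colon\Omega\to\mathbb R^{N\times N}$ be such that all entries $a_{jk}$ belong to $L^1(\Omega,\mathfrak F,\mathbb P)$ and, for every $\omega\in\Omega$, $A(\omega)$ is an ML-matrix, that is, $a_{jk}(\omega)\ge 0$ whenever $j\ne k$. Consider the random linear system $x'=A(\omega\cdot t)x$. Its solutions are understood in the Carath\'eodory sense (absolutely continuous on compact intervals and satisfying the equation for Lebesgue-almost every $t\in\mathbb R$). A real number $\lambda$ is called the top Lyapunov exponent of the system if there is an invariant measurable set $\Omega_1\subset\Omega$ with $\mathbb P(\Omega_1)=1$ such that, for every $\omega\in\Omega_1$, for each $x_0\in\mathbb R^N$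 there is a unique solution $x(\cdot;\omega,x_0)$ on $\mathbb R$ with $x(0;\omega,x_0)=x_0$, and the linear maps $U_\omega(t)x_0:=x(t;\omega,x_0)$ satisfy $$\lim_{t\to\infty}\frac{\ln\|U_\omega(t)\|}{t}=\lambda ,$$ where $\|\cdot\|$ is the operator norm induced by the Euclidean norm. Then the top Lyapunov exponent $\lambda\in\mathbb R$ exists, the function $\omega\mapsto \operatorname{tr}A(\omega)+2\sum_{j<k}\sqrt{a_{jk}(\omega)a_{kj}(\omega)}$ is integrable, and $$\lambda\ \ge\ \frac1N\int_\Omega\Bigl(\operatorname{tr}A(\omega)+2\sum_{j<k}\sqrt{a_{jk}(\omega)\,a_{kj}(\omega)}\Bigr)\,d\mathbb P(\omega).$$ -/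

import Mathlib

open MeasureTheory Filter Topology

/-- A real square matrix is an *ML-matrix* if its off-diagonal entries are nonnegative. -/
def IsMLMatrix {N : ℕ} (M : Matrix (Fin N) (Fin N) ℝ) : Prop :=
  ∀ i j, i ≠ j → 0 ≤ M i j

/-- `θ` is a measure-preserving dynamical system (a measurable flow) on `(Ω, P)`;
`θ t ω` is the point usually written `ω · t`. -/
structure IsMeasurePreservingDS {Ω : Type*} [MeasurableSpace Ω]
    (P : Measure Ω) (θ : ℝ → Ω → Ω) : Prop where
  measurable : Measurable (fun p : ℝ × Ω => θ p.1 p.2)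
  map_zero : ∀ ω, θ 0 ω = ω
  map_add : ∀ s t ω, θ (s + t) ω = θ t (θ s ω)
  measurePreserving : ∀ t, MeasurePreserving (θ t) P P

/-- Invariance of a set under all the bijections `θ t` (for a flow, `θ t ⁻¹' F = F` for all `t`
is the same as `θ t '' F = F` for all `t`). -/
def IsInvariantSet {Ω : Type*} (θ : ℝ → Ω → Ω) (F : Set Ω) : Prop :=
  ∀ t : ℝ, θ t ⁻¹' F = F

/-- Ergodicity: every invariant measurable set has probability zero or one. -/
def IsErgodicDS {Ω : Type*} [MeasurableSpace Ω] (P : Measure Ω) (θ : ℝ → Ω → Ω) : Prop :=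
  ∀ F : Set Ω, MeasurableSet F → IsInvariantSet θ F → P F = 0 ∨ P F = 1

/-- `x` is a Carathéodory solution on `ℝ` of the linear system `x' = B(t) x`: it is absolutely
continuous on every compact interval and satisfies the equation at Lebesgue-almost every `t`. -/
def IsCaratheodorySolution {N : ℕ} (B : ℝ → Matrix (Fin N) (Fin N) ℝ)
    (x : ℝ → EuclideanSpace ℝ (Fin N)) : Prop :=
  (∀ a b : ℝ, AbsolutelyContinuousOnInterval x a b) ∧
    ∀ᵐ t : ℝ, HasDerivAt x (Matrix.toEuclideanLin (B t) (x t)) t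

/-- `U` is the solution operator of `x' = B(t) x`: for every `x₀`, the function `t ↦ U(t) x₀` is
the one and only Carathéodory solution with `x(0) = x₀`. At most one `U` has this property. -/
def IsSolutionOperator {N : ℕ} (B : ℝ → Matrix (Fin N) (Fin N) ℝ)
    (U : ℝ → EuclideanSpace ℝ (Fin N) →L[ℝ] EuclideanSpace ℝ (Fin N)) : Prop :=
  ∀ (x₀ : EuclideanSpace ℝ (Fin N)) (x : ℝ → EuclideanSpace ℝ (Fin N)),
    (IsCaratheodorySolution B x ∧ x 0 = x₀) ↔ x = fun t => U t x₀

/-- `lam` is the top Lyapunov exponent of the random linear system `x' = A(ω · t) x`: on an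
invariant set of full probability the system has a solution operator `U_ω(t)`, and
`log ‖U_ω(t)‖ / t → lam` as `t → ∞` (Euclidean operator norm). -/
def IsTopLyapunovExponent {Ω : Type*} [MeasurableSpace Ω] {N : ℕ} (P : Measure Ω)
    (θ : ℝ → Ω → Ω) (A : Ω → Matrix (Fin N) (Fin N) ℝ) (lam : ℝ) : Prop :=
  ∃ Ω₁ : Set Ω, MeasurableSet Ω₁ ∧ IsInvariantSet θ Ω₁ ∧ P Ω₁ = 1 ∧
    ∀ ω ∈ Ω₁, ∃ U : ℝ → EuclideanSpace ℝ (Fin N) →L[ℝ] EuclideanSpace ℝ (Fin N),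
      IsSolutionOperator (fun t => A (θ t ω)) U ∧
      Tendsto (fun t : ℝ => Real.log ‖U t‖ / t) atTop (𝓝 lam)

/-! The lower bound. The solution `x` starting at `(1, …, 1)` keeps positive coordinates, because
the off-diagonal entries are nonnegative. Hence `∑ log x_i` has derivative `∑ (A x)_i / x_i`, that
is, `tr A` plus the pairs `a_jk x_k / x_j + a_kj x_j / x_k` with `j < k`. The product of the two
terms of a pair does not depend on `x`, so by AM-GM the derivative is at least `mlRate A`, the
integrand of the theorem. Since each `x_i(t)` is at most `‖U(t)‖ √N`, the integral of `mlRate` along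
the orbit is at most `N log ‖U(t)‖` plus a constant (`integral_mlRate_le_log_norm`). Taking
expectations and comparing growth rates in `t` gives the inequality
(`integral_mlRate_le_mul_exponent`).

Existence of the exponent. The functions `log ‖U_ω(n)‖` are subadditive over the time-one map, so a
Kingman-type theorem applies; it is proved by a covering argument (`le_tiling`,
`exists_ae_tendsto_of_subadditive`). Ergodicity of the flow does not pass to its time-one map. The
events that matter are nevertheless invariant under the whole flow, since moving the base point
along its orbit changes `log ‖U(n)‖` only by `o(n)` (`exists_log_shift`,
`frequentlyBelow_zero_one`). Convergence along integers then extends to real times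
(`tendsto_log_of_nat`).

Exceptional orbits. Integrability over `Ω` controls the coefficients along almost every orbit only.
`exists_good_set` collects the good orbits in an invariant set of full measure, and the coefficients
are set to zero elsewhere (`IsTameSystem.indicator`). The fundamental solution is built by the
Picard series, with uniqueness from Grönwall's inequality. -/

open scoped ENNReal

/-! ### Locally integrable functions on the line and absolute continuity -/

section LocallyIntegrable

theorem MeasureTheory.LocallyIntegrable.norm' {E : Type*} [NormedAddCommGroup E] {f : ℝ → E}
    (hf : LocallyIntegrable f) : LocallyIntegrable fun s => ‖f s‖ :=
  fun x => (hf x).norm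

variable {E F G : Type*} [NormedAddCommGroup E] [NormedSpace ℝ E] [NormedAddCommGroup F]
  [NormedSpace ℝ F] [NormedAddCommGroup G] [NormedSpace ℝ G]

theorem MeasureTheory.LocallyIntegrable.intervalIntegrable' {E : Type*} [NormedAddCommGroup E]
    {f : ℝ → E}
    (hf : LocallyIntegrable f) (a b : ℝ) : IntervalIntegrable f volume a b :=
  intervalIntegrable_iff.mpr <|
    (hf.integrableOn_isCompact isCompact_uIcc).mono_set Set.uIoc_subset_uIcc

theorem MeasureTheory.LocallyIntegrable.continuous_integral {f : ℝ → E}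
    (hf : LocallyIntegrable f) (a : ℝ) : Continuous fun t => ∫ s in a..t, f s :=
  intervalIntegral.continuous_primitive hf.intervalIntegrable' a

/-- The product of a locally integrable and a continuous function, for any bounded bilinear
product, is locally integrable. -/
theorem MeasureTheory.LocallyIntegrable.bilin_continuous (L : E →L[ℝ] F →L[ℝ] G) {b : ℝ → E}
    {x : ℝ → F} (hb : LocallyIntegrable b) (hx : Continuous x) :
    LocallyIntegrable fun s => L (b s) (x s) := by
  have h1 : LocallyIntegrable fun s => ‖x s‖ • ‖b s‖ := hb.norm'.continuous_smul hx.norm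
  refine (h1.continuous_smul (continuous_const (y := ‖L‖))).mono
    (L.aestronglyMeasurable_comp₂ hb.aestronglyMeasurable hx.aestronglyMeasurable) ?_
  refine .of_forall fun s => (L.le_opNorm₂ _ _).trans (le_of_eq ?_)
  rw [smul_eq_mul, smul_eq_mul, norm_mul, norm_mul, norm_norm, norm_norm,
    Real.norm_of_nonneg (norm_nonneg L)]
  ring

theorem AbsolutelyContinuousOnInterval.of_dist_le {X Y : Type*} [PseudoMetricSpace X]
    [PseudoMetricSpace Y] {f : ℝ → X} {g : ℝ → Y} {a b : ℝ} (K : ℝ)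
    (hg : AbsolutelyContinuousOnInterval g a b)
    (h : ∀ s ∈ Set.uIcc a b, ∀ t ∈ Set.uIcc a b, dist (f s) (f t) ≤ K * dist (g s) (g t)) :
    AbsolutelyContinuousOnInterval f a b := by
  refine squeeze_zero' (.of_forall fun E => Finset.sum_nonneg fun i _ => dist_nonneg) ?_
    (by simpa using Filter.Tendsto.const_mul K hg)
  rw [eventually_inf_principal]
  filter_upwards with E hE
  rw [Finset.mul_sum]
  exact Finset.sum_le_sum fun i hi => h _ (hE.1 i hi).1 _ (hE.1 i hi).2

theorem MeasureTheory.LocallyIntegrable.absolutelyContinuousOnInterval_integral {f : ℝ → E}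
    (hf : LocallyIntegrable f) (c a b : ℝ) :
    AbsolutelyContinuousOnInterval (fun t => ∫ s in c..t, f s) a b := by
  have hg : AbsolutelyContinuousOnInterval (fun t => ∫ s in a..t, ‖f s‖) a b :=
    (hf.norm'.intervalIntegrable' a b).absolutelyContinuousOnInterval_intervalIntegral (by simp)
  refine hg.of_dist_le 1 fun s _ t _ => ?_
  rw [dist_eq_norm, one_mul, Real.dist_eq, intervalIntegral.integral_interval_sub_left
    (hf.intervalIntegrable' _ _) (hf.intervalIntegrable' _ _),
    intervalIntegral.integral_interval_sub_left
    (hf.norm'.intervalIntegrable' _ _) (hf.norm'.intervalIntegrable' _ _)]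
  exact intervalIntegral.norm_integral_le_abs_integral_norm

/-- A `C¹` function of an absolutely continuous function is absolutely continuous. -/
theorem AbsolutelyContinuousOnInterval.comp_contDiffOn {f φ : ℝ → ℝ} {a b m M : ℝ}
    (hf : AbsolutelyContinuousOnInterval f a b) (hφ : ContDiffOn ℝ 1 φ (Set.Icc m M))
    (hm : ∀ s ∈ Set.uIcc a b, f s ∈ Set.Icc m M) :
    AbsolutelyContinuousOnInterval (fun t => φ (f t)) a b := by
  obtain ⟨K, hK⟩ := hφ.exists_lipschitzOnWith (by decide) (convex_Icc _ _) isCompact_Icc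
  exact hf.of_dist_le K fun s hs t ht => hK.dist_le_mul _ (hm s hs) _ (hm t ht)

/-- Absolute continuity is essential here: it makes the increment the integral of the derivative,
which an almost everywhere derivative alone does not ensure. -/
theorem AbsolutelyContinuousOnInterval.le_of_ae_hasDerivAt_nonneg {f f' : ℝ → ℝ} {a b : ℝ}
    (hab : a ≤ b) (hf : AbsolutelyContinuousOnInterval f a b)
    (hf' : ∀ᵐ t, t ∈ Set.Ioo a b → HasDerivAt f (f' t) t ∧ 0 ≤ f' t) : f a ≤ f b := by
  rw [← sub_nonneg, ← hf.integral_deriv_eq_sub]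
  refine intervalIntegral.integral_nonneg_of_ae_restrict hab ?_
  rw [Filter.EventuallyLE, Measure.restrict_congr_set Ioo_ae_eq_Icc.symm,
    ae_restrict_iff' measurableSet_Ioo]
  filter_upwards [hf'] with t ht h
  rw [(ht h).1.deriv]
  exact (ht h).2

end LocallyIntegrable

/-! ### A Grönwall inequality for locally integrable coefficients -/

section Gronwall

variable {β : ℝ → ℝ}

theorem integral_mul_primitive_pow (hβ : LocallyIntegrable β) (k : ℕ) (t : ℝ) :
    ∫ s in 0..t, β s * (∫ u in 0..s, β u) ^ k = (∫ u in 0..t, β u) ^ (k + 1) / (k + 1) := by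
  -- Powers of the primitive are absolutely continuous, so the chain rule at almost every time can
  -- be integrated.
  have hac : ∀ n : ℕ,
      AbsolutelyContinuousOnInterval (fun s => (∫ u in 0..s, β u) ^ (n + 1)) 0 t := by
    intro n
    induction n with
    | zero => simpa using hβ.absolutelyContinuousOnInterval_integral 0 0 t
    | succ n ih =>
      simp_rw [pow_succ _ (n + 1)]
      exact ih.mul (hβ.absolutelyContinuousOnInterval_integral 0 0 t)
  have h1 := (hac k).integral_deriv_eq_sub
  have h2 : ∫ s in 0..t, deriv (fun s => (∫ u in 0..s, β u) ^ (k + 1)) s =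
      ∫ s in 0..t, ((k : ℝ) + 1) * (β s * (∫ u in 0..s, β u) ^ k) := by
    refine intervalIntegral.integral_congr_ae ?_
    filter_upwards [LocallyIntegrable.ae_hasDerivAt_integral hβ] with s hs _
    rw [((hs 0).fun_pow (k + 1)).deriv]
    push_cast
    ring
  rw [h2, intervalIntegral.integral_const_mul] at h1
  have hk : (k : ℝ) + 1 ≠ 0 := by positivity
  rw [eq_div_iff hk, mul_comm, h1]
  simp

theorem abs_integral_mul_abs_primitive_pow (hβ : LocallyIntegrable β) (hβ0 : ∀ s, 0 ≤ β s)
    (k : ℕ) (t : ℝ) :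
    |∫ s in 0..t, β s * |∫ u in 0..s, β u| ^ k| = |∫ u in 0..t, β u| ^ (k + 1) / (k + 1) := by
  have key : |∫ s in 0..t, β s * |∫ u in 0..s, β u| ^ k| =
      |∫ s in 0..t, β s * (∫ u in 0..s, β u) ^ k| := by
    rcases le_total 0 t with ht | ht
    · congr 1
      refine intervalIntegral.integral_congr fun s hs => ?_
      rw [Set.uIcc_of_le ht] at hs
      rw [abs_of_nonneg (intervalIntegral.integral_nonneg hs.1 fun _ _ => hβ0 _)]
    · have : ∫ s in 0..t, β s * |∫ u in 0..s, β u| ^ k =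
          ∫ s in 0..t, (-1) ^ k * (β s * (∫ u in 0..s, β u) ^ k) := by
        refine intervalIntegral.integral_congr fun s hs => ?_
        rw [Set.uIcc_of_ge ht] at hs
        rw [abs_of_nonpos, neg_pow]
        · ring
        · rw [intervalIntegral.integral_symm, neg_nonpos]
          exact intervalIntegral.integral_nonneg hs.2 fun _ _ => hβ0 _
      rw [this, intervalIntegral.integral_const_mul, abs_mul, abs_pow]
      simp
  rw [key, integral_mul_primitive_pow hβ, abs_div, abs_pow, abs_of_nonneg (by positivity :
    (0 : ℝ) ≤ k + 1)]

theorem abs_integral_mul_abs_primitive_pow_div_factorial (hβ : LocallyIntegrable β)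
    (hβ0 : ∀ s, 0 ≤ β s) (k : ℕ) (t : ℝ) :
    |∫ s in 0..t, β s * (|∫ u in 0..s, β u| ^ k / k.factorial)| =
      |∫ u in 0..t, β u| ^ (k + 1) / (k + 1).factorial := by
  have : ∀ s, β s * (|∫ u in 0..s, β u| ^ k / k.factorial) =
      (k.factorial : ℝ)⁻¹ * (β s * |∫ u in 0..s, β u| ^ k) := fun s => by ring
  simp_rw [this]
  rw [intervalIntegral.integral_const_mul, abs_mul, abs_integral_mul_abs_primitive_pow hβ hβ0,
    Nat.factorial_succ, abs_of_nonneg (by positivity)]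
  push_cast
  field_simp

/-- Inserting the inequality into itself `n` times yields a partial sum of the exponential series
plus the remainder `C V ^ n / n!`, which tends to zero. Absolute values of integrals treat both time
directions together. -/
theorem le_mul_exp_of_le_add_abs_integral (hβ : LocallyIntegrable β) (hβ0 : ∀ s, 0 ≤ β s)
    {u : ℝ → ℝ} (hu : Continuous u) {c : ℝ}
    (h : ∀ t, u t ≤ c + |∫ s in 0..t, β s * u s|) (hu0 : ∀ t, 0 ≤ u t) (hc : 0 ≤ c) (t : ℝ) :
    u t ≤ c * Real.exp |∫ s in 0..t, β s| := by
  obtain ⟨C, hC⟩ := (isCompact_uIcc (a := (0 : ℝ)) (b := t)).exists_bound_of_continuousOn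
    (f := u) hu.continuousOn
  set V : ℝ → ℝ := fun t => |∫ s in 0..t, β s| with hV
  have hVc : Continuous V := (hβ.continuous_integral 0).abs
  have hint : ∀ w : ℝ → ℝ, Continuous w → ∀ s, IntervalIntegrable (fun r => β r * w r) volume 0 s :=
    fun w hw s => (hβ.bilin_continuous (ContinuousLinearMap.mul ℝ ℝ) hw).intervalIntegrable' 0 s
  have hC0 : 0 ≤ C := (norm_nonneg _).trans (hC 0 (by simp))
  have key : ∀ n : ℕ, ∀ s ∈ Set.uIcc 0 t, u s ≤
      c * ∑ j ∈ Finset.range n, V s ^ j / j.factorial + C * (V s ^ n / n.factorial) := by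
    intro n
    induction n with
    | zero =>
      intro s hs
      simpa using (le_abs_self _).trans (hC s hs)
    | succ n ih =>
      intro s hs
      set w : ℝ → ℝ := fun s => c * ∑ j ∈ Finset.range n, V s ^ j / j.factorial +
        C * (V s ^ n / n.factorial) with hw
      have hwc : Continuous w := by fun_prop
      have hsub : Set.uIoc 0 s ⊆ Set.uIcc 0 t :=
        Set.uIoc_subset_uIcc.trans (Set.uIcc_subset_uIcc (by simp) hs)
      have h1 : |∫ r in 0..s, β r * u r| ≤ |∫ r in 0..s, β r * w r| := by
        rw [← Real.norm_eq_abs]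
        refine intervalIntegral.norm_integral_le_abs_of_norm_le ?_ (hint w hwc s)
        refine (ae_restrict_iff' measurableSet_uIoc).2 (.of_forall fun r hr => ?_)
        rw [Real.norm_of_nonneg (mul_nonneg (hβ0 r) (hu0 r))]
        exact mul_le_mul_of_nonneg_left (ih r (hsub hr)) (hβ0 r)
      have h2 : ∫ r in 0..s, β r * w r =
          c * ∑ j ∈ Finset.range n, (∫ r in 0..s, β r * (V r ^ j / j.factorial)) +
            C * ∫ r in 0..s, β r * (V r ^ n / n.factorial) := by
        rw [← intervalIntegral.integral_finsetSum fun j _ =>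
            hint (fun r => V r ^ j / j.factorial) (by fun_prop) s,
          ← intervalIntegral.integral_const_mul, ← intervalIntegral.integral_const_mul,
          ← intervalIntegral.integral_add]
        · refine intervalIntegral.integral_congr fun r _ => ?_
          simp only [hw, mul_add, Finset.mul_sum]
          congr 1
          · exact Finset.sum_congr rfl fun j _ => by ring
          · ring
        · simp_rw [Finset.mul_sum]
          have h3 := hint (fun r => c * ∑ j ∈ Finset.range n, V r ^ j / j.factorial)
            (by fun_prop) s
          refine h3.congr fun r _ => ?_
          simp only [Finset.mul_sum]
          exact Finset.sum_congr rfl fun j _ => by ring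
        · exact (hint _ (by fun_prop) s).const_mul C
      have h3 : |∫ r in 0..s, β r * w r| ≤
          c * ∑ j ∈ Finset.range n, V s ^ (j + 1) / (j + 1).factorial +
            C * (V s ^ (n + 1) / (n + 1).factorial) := by
        rw [h2]
        refine (abs_add_le _ _).trans (add_le_add ?_ ?_)
        · rw [abs_mul, abs_of_nonneg hc]
          refine mul_le_mul_of_nonneg_left ((Finset.abs_sum_le_sum_abs _ _).trans (le_of_eq ?_)) hc
          exact Finset.sum_congr rfl fun j _ =>
            abs_integral_mul_abs_primitive_pow_div_factorial hβ hβ0 j s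
        · rw [abs_mul, abs_of_nonneg hC0,
            abs_integral_mul_abs_primitive_pow_div_factorial hβ hβ0 n s]
      have h4 := (h s).trans (add_le_add_right (h1.trans h3) c)
      rw [Finset.sum_range_succ']
      simp only [pow_zero, Nat.factorial_zero, Nat.cast_one, div_one]
      linarith
  have hexp : HasSum (fun n : ℕ => V t ^ n / n.factorial) (Real.exp (V t)) := by
    rw [Real.exp_eq_exp_ℝ]
    exact NormedSpace.expSeries_div_hasSum_exp (V t)
  have hlim := (hexp.tendsto_sum_nat.const_mul c).add
    ((FloorSemiring.tendsto_pow_div_factorial_atTop (V t)).const_mul C)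
  rw [mul_zero, add_zero] at hlim
  exact ge_of_tendsto' hlim fun n => key n t (by simp)

end Gronwall

/-! ### The fundamental solution of a linear system with locally integrable coefficients -/

section FundamentalSolution

variable {𝔸 : Type*} [NormedRing 𝔸] [NormedAlgebra ℝ 𝔸]

/-- The terms of the Picard (Peano–Baker) series of `X' = b X`, `X 0 = 1`. -/
noncomputable def picardTerm (b : ℝ → 𝔸) : ℕ → ℝ → 𝔸
  | 0 => fun _ => 1
  | k + 1 => fun t => ∫ s in 0..t, b s * picardTerm b k s

/-- The fundamental solution of `X' = b X`, `X 0 = 1`. -/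
noncomputable def fundSol (b : ℝ → 𝔸) (t : ℝ) : 𝔸 := ∑' k, picardTerm b k t

variable {b : ℝ → 𝔸}

theorem MeasureTheory.LocallyIntegrable.mul_continuous' (hb : LocallyIntegrable b) {x : ℝ → 𝔸}
    (hx : Continuous x) : LocallyIntegrable fun s => b s * x s :=
  hb.bilin_continuous (ContinuousLinearMap.mul ℝ 𝔸) hx

theorem continuous_picardTerm (hb : LocallyIntegrable b) (k : ℕ) :
    Continuous (picardTerm b k) := by
  induction k with
  | zero => exact continuous_const
  | succ k ih => exact (hb.mul_continuous' ih).continuous_integral 0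

/-- The factor `‖1‖` appears because the norm of the unit of `𝔸` is not assumed to be one. -/
theorem norm_picardTerm_le (hb : LocallyIntegrable b) (k : ℕ) (t : ℝ) :
    ‖picardTerm b k t‖ ≤ ‖(1 : 𝔸)‖ * (|∫ s in 0..t, ‖b s‖| ^ k / k.factorial) := by
  induction k generalizing t with
  | zero => simp [picardTerm]
  | succ k ih =>
    have hβ := hb.norm'
    have hc : Continuous fun t => ‖(1 : 𝔸)‖ * (|∫ s in 0..t, ‖b s‖| ^ k / k.factorial) := by
      have := hβ.continuous_integral 0
      fun_prop
    rw [← abs_integral_mul_abs_primitive_pow_div_factorial hβ (fun _ => norm_nonneg _),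
      ← abs_of_nonneg (norm_nonneg (1 : 𝔸)), ← abs_mul, ← intervalIntegral.integral_const_mul]
    refine intervalIntegral.norm_integral_le_abs_of_norm_le (.of_forall fun s => ?_) ?_
    · refine (norm_mul_le _ _).trans ?_
      refine (mul_le_mul_of_nonneg_left (ih s) (norm_nonneg _)).trans (le_of_eq ?_)
      ring
    · refine ((hβ.bilin_continuous (ContinuousLinearMap.mul ℝ ℝ) hc).intervalIntegrable'
        0 t).congr fun s _ => ?_
      simp only [ContinuousLinearMap.mul_apply']
      ring

theorem hasSum_picardTerm [CompleteSpace 𝔸] (hb : LocallyIntegrable b) (t : ℝ) :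
    HasSum (fun k => picardTerm b k t) (fundSol b t) :=
  (Summable.of_norm_bounded ((Real.summable_pow_div_factorial _).mul_left _)
    fun k => norm_picardTerm_le hb k t).hasSum

theorem exists_forall_norm_picardTerm_le (hb : LocallyIntegrable b) (R : ℝ) :
    ∃ C : ℝ, ∀ k, ∀ t ∈ Set.Icc (-R) R,
      ‖picardTerm b k t‖ ≤ ‖(1 : 𝔸)‖ * (C ^ k / k.factorial) := by
  obtain ⟨C, hC⟩ := (isCompact_Icc (a := -R) (b := R)).exists_bound_of_continuousOn
    (hb.norm'.continuous_integral 0).continuousOn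
  refine ⟨C, fun k t ht => (norm_picardTerm_le hb k t).trans ?_⟩
  have := hC t ht
  rw [Real.norm_eq_abs] at this
  gcongr

variable [CompleteSpace 𝔸]

theorem continuous_fundSol (hb : LocallyIntegrable b) : Continuous (fundSol b) := by
  refine continuous_iff_continuousAt.2 fun t => ?_
  obtain ⟨C, hC⟩ := exists_forall_norm_picardTerm_le hb (|t| + 1)
  have h : ContinuousOn (fundSol b) (Set.Icc (-(|t| + 1)) (|t| + 1)) :=
    continuousOn_tsum (fun k => (continuous_picardTerm hb k).continuousOn)
      ((Real.summable_pow_div_factorial C).mul_left _) hC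
  exact h.continuousAt (Icc_mem_nhds (by linarith [neg_abs_le t]) (by linarith [le_abs_self t]))

theorem fundSol_eq (hb : LocallyIntegrable b) (t : ℝ) :
    fundSol b t = 1 + ∫ s in 0..t, b s * fundSol b s := by
  obtain ⟨C, hC⟩ := exists_forall_norm_picardTerm_le hb |t|
  have hsub : Set.uIoc 0 t ⊆ Set.Icc (-|t|) |t| := fun s hs => by
    rcases le_total 0 t with h | h
    · rw [Set.uIoc_of_le h] at hs
      rw [abs_of_nonneg h]
      exact ⟨by linarith [hs.1], hs.2⟩
    · rw [Set.uIoc_of_ge h] at hs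
      rw [abs_of_nonpos h]
      exact ⟨by linarith [hs.1], by linarith [hs.2]⟩
  have h1 : HasSum (fun k => ∫ s in 0..t, b s * picardTerm b k s)
      (∫ s in 0..t, b s * fundSol b s) := by
    -- The factorial bound, uniform on the interval, lets the series be integrated term by term;
    -- this shifts its index by one.
    refine intervalIntegral.hasSum_integral_of_dominated_convergence
      (fun k s => ‖b s‖ * (‖(1 : 𝔸)‖ * (C ^ k / k.factorial)))
      (fun k => (hb.mul_continuous' (continuous_picardTerm hb k)).aestronglyMeasurable.restrict)
      (fun k => .of_forall fun s hs => (norm_mul_le _ _).trans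
        (mul_le_mul_of_nonneg_left (hC k s (hsub hs)) (norm_nonneg _)))
      (.of_forall fun s _ => ((Real.summable_pow_div_factorial C).mul_left _).mul_left _)
      ?_ (.of_forall fun s _ => (hasSum_picardTerm hb s).mul_left _)
    simp_rw [tsum_mul_left]
    exact (hb.norm'.intervalIntegrable' 0 t).mul_const _
  have h2 := (hasSum_nat_add_iff' (f := fun k => picardTerm b k t) 1).2 (hasSum_picardTerm hb t)
  simp only [Finset.range_one, Finset.sum_singleton] at h2
  exact (sub_eq_iff_eq_add'.1 (h2.unique h1))

end FundamentalSolution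

/-! ### Uniqueness, the cocycle identity and two-sided norm bounds. -/

section LinearSystem

variable {E : Type*} [NormedAddCommGroup E] [NormedSpace ℝ E]
  {b : ℝ → E →L[ℝ] E}

theorem MeasureTheory.LocallyIntegrable.clm_apply_continuous (hb : LocallyIntegrable b)
    {x : ℝ → E} (hx : Continuous x) : LocallyIntegrable fun s => b s (x s) :=
  hb.bilin_continuous (ContinuousLinearMap.id ℝ (E →L[ℝ] E)) hx

/-- Grönwall's estimate for a solution of the integral equation. -/
theorem norm_le_of_eq_add_integral (hb : LocallyIntegrable b) {x : ℝ → E} (hx : Continuous x)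
    {x₀ : E} (h : ∀ t, x t = x₀ + ∫ s in 0..t, b s (x s)) (t : ℝ) :
    ‖x t‖ ≤ ‖x₀‖ * Real.exp |∫ s in 0..t, ‖b s‖| := by
  refine le_mul_exp_of_le_add_abs_integral hb.norm' (fun _ => norm_nonneg _) hx.norm
    (fun t => ?_) (fun _ => norm_nonneg _) (norm_nonneg _) t
  rw [h t]
  refine (norm_add_le _ _).trans (add_le_add_right ?_ _)
  refine intervalIntegral.norm_integral_le_abs_of_norm_le (.of_forall fun s => ?_) ?_
  · exact (b s).le_opNorm _
  · exact (hb.norm'.bilin_continuous (ContinuousLinearMap.mul ℝ ℝ)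
      hx.norm).intervalIntegrable' 0 t

theorem eq_of_eq_add_integral (hb : LocallyIntegrable b) {x y : ℝ → E} (hx : Continuous x)
    (hy : Continuous y) {x₀ : E} (h : ∀ t, x t = x₀ + ∫ s in 0..t, b s (x s))
    (h' : ∀ t, y t = x₀ + ∫ s in 0..t, b s (y s)) : x = y := by
  funext t
  have := norm_le_of_eq_add_integral hb (hx.sub hy) (x₀ := 0) (fun t => ?_) t
  · simpa [sub_eq_zero] using this
  · simp only [Pi.sub_apply, map_sub]
    rw [intervalIntegral.integral_sub ((hb.clm_apply_continuous hx).intervalIntegrable' _ _)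
      ((hb.clm_apply_continuous hy).intervalIntegrable' _ _), h t, h' t]
    abel

variable [CompleteSpace E]

theorem fundSol_apply_eq (hb : LocallyIntegrable b) (x₀ : E) (t : ℝ) :
    fundSol b t x₀ = x₀ + ∫ s in 0..t, b s (fundSol b s x₀) := by
  conv_lhs => rw [fundSol_eq hb t]
  have := (ContinuousLinearMap.apply ℝ E x₀).intervalIntegral_comp_comm
    ((hb.mul_continuous' (continuous_fundSol hb)).intervalIntegrable' 0 t)
  simp only [ContinuousLinearMap.apply_apply, mul_apply_eq_comp] at this
  simp [this]

theorem continuous_fundSol_apply (hb : LocallyIntegrable b) (x₀ : E) :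
    Continuous fun t => fundSol b t x₀ :=
  (ContinuousLinearMap.apply ℝ E x₀).continuous.comp (continuous_fundSol hb)

theorem eq_fundSol_apply (hb : LocallyIntegrable b) {x : ℝ → E} (hx : Continuous x) {x₀ : E}
    (h : ∀ t, x t = x₀ + ∫ s in 0..t, b s (x s)) : x = fun t => fundSol b t x₀ :=
  eq_of_eq_add_integral hb hx (continuous_fundSol_apply hb x₀) h (fundSol_apply_eq hb x₀)

theorem norm_fundSol_le (hb : LocallyIntegrable b) (t : ℝ) :
    ‖fundSol b t‖ ≤ Real.exp |∫ s in 0..t, ‖b s‖| := by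
  refine ContinuousLinearMap.opNorm_le_bound _ (Real.exp_nonneg _) fun x₀ => ?_
  rw [mul_comm]
  exact norm_le_of_eq_add_integral hb (continuous_fundSol_apply hb x₀) (fundSol_apply_eq hb x₀) t

theorem MeasureTheory.LocallyIntegrable.comp_add_right' {F : Type*} [NormedAddCommGroup F]
    {f : ℝ → F} (hf : LocallyIntegrable f) (r : ℝ) : LocallyIntegrable fun s => f (s + r) := by
  refine (locallyIntegrable_iff).2 fun k hk => ?_
  have h := (locallyIntegrable_iff.1 hf) _ (hk.image (continuous_add_const r))
  exact ((measurePreserving_add_right volume r).integrableOn_image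
    (MeasurableEquiv.addRight r).measurableEmbedding).1 h

/-- The cocycle identity. -/
theorem fundSol_add (hb : LocallyIntegrable b) (s t : ℝ) :
    fundSol b (t + s) = fundSol (fun u => b (u + s)) t * fundSol b s := by
  ext x₀
  have := eq_fundSol_apply (hb.comp_add_right' s) (x := fun t => fundSol b (t + s) x₀)
    (x₀ := fundSol b s x₀) ((continuous_fundSol_apply hb x₀).comp (continuous_add_const s))
    fun t => ?_
  · exact congrFun this t
  · rw [intervalIntegral.integral_comp_add_right (fun u => b u (fundSol b u x₀)), zero_add,
      fundSol_apply_eq hb x₀ s, add_assoc, intervalIntegral.integral_add_adjacent_intervals,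
      ← fundSol_apply_eq hb x₀]
    all_goals
      exact (hb.clm_apply_continuous (continuous_fundSol_apply hb x₀)).intervalIntegrable' _ _

theorem fundSol_zero (b : ℝ → E →L[ℝ] E) (hb : LocallyIntegrable b) : fundSol b 0 = 1 := by
  rw [fundSol_eq hb]
  simp

theorem fundSol_neg_mul (hb : LocallyIntegrable b) (t : ℝ) :
    fundSol (fun u => b (u + t)) (-t) * fundSol b t = 1 := by
  rw [← fundSol_add hb, neg_add_cancel, fundSol_zero b hb]

/-- Running back from time `t` inverts the fundamental solution, and the upper bound for the inverse
is a lower bound for the solution. -/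
theorem exp_neg_le_norm_fundSol [Nontrivial E] (hb : LocallyIntegrable b) (t : ℝ) :
    Real.exp (-|∫ s in 0..t, ‖b s‖|) ≤ ‖fundSol b t‖ := by
  have h1 := norm_mul_le (fundSol (fun u => b (u + t)) (-t)) (fundSol b t)
  rw [fundSol_neg_mul hb, norm_one] at h1
  have h2 := norm_fundSol_le (hb.comp_add_right' t) (-t)
  rw [intervalIntegral.integral_comp_add_right (fun u => ‖b u‖), zero_add, neg_add_cancel,
    intervalIntegral.integral_symm, abs_neg] at h2
  rw [Real.exp_neg, inv_le_iff_one_le_mul₀' (Real.exp_pos _)]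
  exact h1.trans (mul_le_mul_of_nonneg_right h2 (norm_nonneg _))

theorem norm_fundSol_pos [Nontrivial E] (hb : LocallyIntegrable b) (t : ℝ) :
    0 < ‖fundSol b t‖ :=
  (Real.exp_pos _).trans_le (exp_neg_le_norm_fundSol hb t)

theorem abs_log_norm_fundSol_le [Nontrivial E] (hb : LocallyIntegrable b) (t : ℝ) :
    |Real.log ‖fundSol b t‖| ≤ |∫ s in 0..t, ‖b s‖| := by
  have h := norm_fundSol_pos hb t
  rw [abs_le, Real.le_log_iff_exp_le h, Real.log_le_iff_le_exp h]
  exact ⟨exp_neg_le_norm_fundSol hb t, norm_fundSol_le hb t⟩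

theorem log_norm_fundSol_add_le [Nontrivial E] (hb : LocallyIntegrable b) (s t : ℝ) :
    Real.log ‖fundSol b (t + s)‖ ≤
      Real.log ‖fundSol (fun u => b (u + s)) t‖ + Real.log ‖fundSol b s‖ := by
  rw [← Real.log_mul (norm_fundSol_pos (hb.comp_add_right' s) t).ne' (norm_fundSol_pos hb s).ne']
  refine Real.log_le_log (norm_fundSol_pos hb _) ?_
  rw [fundSol_add hb]
  exact norm_mul_le _ _

end LinearSystem

/-! ### Carathéodory solutions and the integral equation. -/

section Caratheodory

variable {N : ℕ} {B : ℝ → Matrix (Fin N) (Fin N) ℝ}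
  {b : ℝ → EuclideanSpace ℝ (Fin N) →L[ℝ] EuclideanSpace ℝ (Fin N)}

/-- A Carathéodory solution minus its integral is absolutely continuous with zero derivative almost
everywhere, hence constant. Agreement of `B` and `b` at almost every time suffices, so the
coefficients may later be altered on a null set. -/
theorem isCaratheodorySolution_iff (hb : LocallyIntegrable b)
    (hB : ∀ᵐ t, ∀ v, Matrix.toEuclideanLin (B t) v = b t v) (x : ℝ → EuclideanSpace ℝ (Fin N))
    (x₀ : EuclideanSpace ℝ (Fin N)) :
    (IsCaratheodorySolution B x ∧ x 0 = x₀) ↔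
      Continuous x ∧ ∀ t, x t = x₀ + ∫ s in 0..t, b s (x s) := by
  constructor
  · rintro ⟨⟨hac, hder⟩, h0⟩
    have hc : Continuous x := continuous_iff_continuousAt.2 fun t =>
      (hac (t - 1) (t + 1)).continuousOn.continuousAt
        (by rw [Set.uIcc_of_le (by linarith)]; exact Icc_mem_nhds (by linarith) (by linarith))
    refine ⟨hc, fun t => ?_⟩
    have hbx := hb.clm_apply_continuous hc
    have hz : ∀ᵐ s, s ∈ Set.uIcc 0 t →
        HasDerivAt (fun s => x s - ∫ r in 0..s, b r (x r)) 0 s := by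
      filter_upwards [hder, hB, LocallyIntegrable.ae_hasDerivAt_integral hbx] with s h1 h2 h3 _
      simpa [h2] using h1.fun_sub (h3 0)
    obtain ⟨C, hC⟩ := AbsolutelyContinuousOnInterval.const_of_ae_hasDerivAt_zero
      ((hac 0 t).sub (hbx.absolutelyContinuousOnInterval_integral 0 0 t)) hz
    have h1 := hC 0 (by simp)
    have h2 := hC t (by simp)
    simp only [Pi.sub_apply, intervalIntegral.integral_same, sub_zero, h0] at h1 h2
    rw [h1, ← h2]
    abel
  · rintro ⟨hc, h⟩
    have hbx := hb.clm_apply_continuous hc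
    have hx : x = fun t => x₀ + ∫ s in 0..t, b s (x s) := funext h
    refine ⟨⟨fun s t => ?_, ?_⟩, by rw [h]; simp⟩
    · refine (hbx.absolutelyContinuousOnInterval_integral 0 s t).of_dist_le 1 fun r _ r' _ => ?_
      rw [h r, h r']
      simp
    · filter_upwards [hB, LocallyIntegrable.ae_hasDerivAt_integral hbx] with t h2 h3
      rw [h2]
      exact ((h3 0).const_add x₀).congr_of_eventuallyEq (.of_forall h)

theorem isSolutionOperator_fundSol (hb : LocallyIntegrable b)
    (hB : ∀ᵐ t, ∀ v, Matrix.toEuclideanLin (B t) v = b t v) :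
    IsSolutionOperator B (fundSol b) := by
  intro x₀ x
  rw [isCaratheodorySolution_iff hb hB]
  constructor
  · rintro ⟨hc, h⟩
    exact eq_fundSol_apply hb hc h
  · rintro rfl
    exact ⟨continuous_fundSol_apply hb x₀, fundSol_apply_eq hb x₀⟩

theorem IsSolutionOperator.unique
    {U U' : ℝ → EuclideanSpace ℝ (Fin N) →L[ℝ] EuclideanSpace ℝ (Fin N)}
    (h : IsSolutionOperator B U) (h' : IsSolutionOperator B U') : U = U' := by
  funext t
  ext1 x₀
  exact congrFun ((h' x₀ _).1 ((h x₀ _).2 rfl)) t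

end Caratheodory

/-! ### A subadditive ergodic theorem with constant limits -/

section Tiling

variable {Ω : Type*} {T : Ω → Ω} {f : ℕ → Ω → ℝ} {h : Ω → ℝ}

/-- The covering argument behind the subadditive ergodic theorem: if off `B` the average of `f` is
at most `q` for some time `n ≤ M`, then it is almost at most `q` for all times. -/
theorem le_tiling (hsub : ∀ m n ω, f (m + n) ω ≤ f m ω + f n (T^[m] ω)) (h0 : ∀ ω, 0 ≤ h ω)
    (hf : ∀ n ω, f n ω ≤ ∑ k ∈ Finset.range n, h (T^[k] ω)) {q : ℝ} {M : ℕ} {B : Set Ω}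
    (hM : 1 ≤ M) (hB : ∀ ω ∉ B, ∃ n, 1 ≤ n ∧ n ≤ M ∧ f n ω ≤ q * n) (N : ℕ) (ω : Ω) :
    f N ω ≤ q * N + ∑ k ∈ Finset.range N, B.indicator (fun ω => h ω + |q|) (T^[k] ω) +
      ∑ k ∈ Finset.Ico (N - M) N, (h (T^[k] ω) + |q|) := by
  have hψ : ∀ ω, 0 ≤ h ω + |q| := fun ω => add_nonneg (h0 ω) (abs_nonneg q)
  have hφ : ∀ ω, 0 ≤ B.indicator (fun ω => h ω + |q|) ω :=
    fun ω => Set.indicator_nonneg (fun ω _ => hψ ω) ω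
  induction N using Nat.strong_induction_on generalizing ω with
  | _ N ih =>
    -- A first block of length `n` is split off by subadditivity, and the induction hypothesis
    -- covers the rest of the orbit.
    have step : ∀ n, 1 ≤ n → n ≤ M → n ≤ N →
        f n ω ≤ q * n + ∑ k ∈ Finset.range n, B.indicator (fun ω => h ω + |q|) (T^[k] ω) →
        f N ω ≤ q * N + ∑ k ∈ Finset.range N, B.indicator (fun ω => h ω + |q|) (T^[k] ω) +
          ∑ k ∈ Finset.Ico (N - M) N, (h (T^[k] ω) + |q|) := by
      intro n hn1 hnM hnN hfn
      have h1 := hsub n (N - n) ω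
      rw [Nat.add_sub_cancel' hnN] at h1
      have h2 := ih (N - n) (by omega) (T^[n] ω)
      have h3 : ∑ k ∈ Finset.range N, B.indicator (fun ω => h ω + |q|) (T^[k] ω) =
          ∑ k ∈ Finset.range n, B.indicator (fun ω => h ω + |q|) (T^[k] ω) +
          ∑ k ∈ Finset.range (N - n), B.indicator (fun ω => h ω + |q|) (T^[k] (T^[n] ω)) := by
        conv_lhs => rw [← Nat.add_sub_cancel' hnN, Finset.sum_range_add]
        simp_rw [← Function.iterate_add_apply, add_comm]
      have h4 : ∑ k ∈ Finset.Ico (N - n - M) (N - n), (h (T^[k] (T^[n] ω)) + |q|) ≤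
          ∑ k ∈ Finset.Ico (N - M) N, (h (T^[k] ω) + |q|) := by
        simp_rw [← Function.iterate_add_apply]
        rw [Finset.sum_Ico_add' (fun k => h (T^[k] ω) + |q|)]
        refine Finset.sum_le_sum_of_subset_of_nonneg ?_ fun k _ _ => hψ _
        intro k hk
        rw [Finset.mem_Ico] at hk ⊢
        omega
      have h5 : ((N - n : ℕ) : ℝ) = N - n := Nat.cast_sub hnN
      rw [h5] at h2
      linarith
    -- When at most `M` steps remain they are paid for by `h`; the summand `|q|` compensates for a
    -- possibly negative `q * N`. Otherwise a point of `B` uses a block of length one, at the cost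
    -- `h ≤ q + (h + |q|)`, and a point off `B` uses its good time.
    rcases le_or_gt N M with hNM | hNM
    · rw [Nat.sub_eq_zero_of_le hNM, ← Finset.range_eq_Ico, Finset.sum_add_distrib]
      have h1 := hf N ω
      have h2 : 0 ≤ ∑ k ∈ Finset.range N, B.indicator (fun ω => h ω + |q|) (T^[k] ω) :=
        Finset.sum_nonneg fun k _ => hφ _
      have h3 : -(|q| * N) ≤ q * N := by
        rw [← neg_mul]
        exact mul_le_mul_of_nonneg_right (neg_abs_le q) (Nat.cast_nonneg _)
      simp only [Finset.sum_const, Finset.card_range, nsmul_eq_mul]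
      linarith
    · by_cases hω : ω ∈ B
      · refine step 1 le_rfl hM (by omega) ((hf 1 ω).trans ?_)
        simp only [Finset.sum_range_one, Function.iterate_zero, id_eq,
          Set.indicator_of_mem hω, Nat.cast_one, mul_one]
        linarith [neg_abs_le q]
      · obtain ⟨n, hn1, hnM, hn⟩ := hB ω hω
        exact step n hn1 hnM (by omega) (hn.trans (le_add_of_nonneg_right
          (Finset.sum_nonneg fun k _ => hφ _)))

end Tiling

/-! ### Averages of subadditive sequences. -/

section Subadditive

variable {Ω : Type*} [MeasurableSpace Ω] {P : Measure Ω} {T : Ω → Ω} {f : ℕ → Ω → ℝ} {h : Ω → ℝ}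

theorem MeasureTheory.MeasurePreserving.integral_comp_iterate (hT : MeasurePreserving T P P)
    {φ : Ω → ℝ} (hφ : Measurable φ) (k : ℕ) : ∫ ω, φ (T^[k] ω) ∂P = ∫ ω, φ ω ∂P := by
  have := (hT.iterate k).map_eq
  conv_rhs => rw [← this]
  exact (integral_map (hT.iterate k).measurable.aemeasurable hφ.aestronglyMeasurable).symm

theorem MeasureTheory.MeasurePreserving.integrable_comp_iterate (hT : MeasurePreserving T P P)
    {φ : Ω → ℝ} (hφ : Integrable φ P) (k : ℕ) : Integrable (fun ω => φ (T^[k] ω)) P :=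
  (hT.iterate k).integrable_comp_of_integrable hφ

variable [IsProbabilityMeasure P]

/-- The sets on which no time up to `M` is good decrease to a null set, so the integral of `h + |q|`
over them becomes small. -/
theorem exists_tiling (hfm : ∀ n, Measurable (f n))
    (hsub : ∀ m n ω, f (m + n) ω ≤ f m ω + f n (T^[m] ω)) (h0 : ∀ ω, 0 ≤ h ω)
    (hh : Integrable h P) (hf : ∀ n ω, f n ω ≤ ∑ k ∈ Finset.range n, h (T^[k] ω)) {q : ℝ}
    (hq : ∀ᵐ ω ∂P, ∃ n : ℕ, 1 ≤ n ∧ f n ω ≤ q * n) {ε : ℝ} (hε : 0 < ε) :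
    ∃ (M : ℕ) (B : Set Ω), MeasurableSet B ∧ ∫ ω, B.indicator (fun ω => h ω + |q|) ω ∂P < ε ∧
      ∀ N ω, f N ω ≤ q * N + ∑ k ∈ Finset.range N, B.indicator (fun ω => h ω + |q|) (T^[k] ω) +
        ∑ k ∈ Finset.Ico (N - M) N, (h (T^[k] ω) + |q|) := by
  set B : ℕ → Set Ω := fun M => {ω | ∀ n : ℕ, 1 ≤ n → n ≤ M → q * n < f n ω} with hBdef
  have hBm : ∀ M, MeasurableSet (B M) := fun M => by
    simp only [hBdef, Set.ofPred_forall]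
    exact MeasurableSet.iInter fun n => MeasurableSet.iInter fun _ => MeasurableSet.iInter fun _ =>
      measurableSet_lt measurable_const (hfm n)
  have hBanti : Antitone B := fun M M' hMM' ω hω n h1 hn => hω n h1 (hn.trans hMM')
  have hB0 : P (⋂ M, B M) = 0 := by
    refine measure_mono_null ?_ hq
    intro ω hω hcon
    obtain ⟨n, hn, hfn⟩ := hcon
    exact absurd (Set.mem_iInter.1 hω n n hn le_rfl) (not_lt.2 hfn)
  have hlim := tendsto_setIntegral_of_antitone hBm hBanti
    ⟨0, (hh.add (integrable_const |q|)).integrableOn⟩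
  rw [setIntegral_measure_zero _ hB0] at hlim
  obtain ⟨M, hM, hM1⟩ := ((hlim.eventually_lt_const hε).and (eventually_ge_atTop 1)).exists
  refine ⟨M, B M, hBm M, ?_, fun N ω => le_tiling hsub h0 hf hM1 (fun ω hω => ?_) N ω⟩
  · rw [integral_indicator (hBm M)]
    exact hM
  · simp only [hBdef, Set.mem_ofPred_eq, not_forall, not_lt] at hω
    obtain ⟨n, h1, h2, h3⟩ := hω
    exact ⟨n, h1, h2, h3⟩

/-- Integrating the tiling inequality costs at most `ε` per step on the bad set; the final window
contributes a constant independent of `N`. -/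
theorem exists_integral_le (hT : MeasurePreserving T P P) (hfm : ∀ n, Measurable (f n))
    (hsub : ∀ m n ω, f (m + n) ω ≤ f m ω + f n (T^[m] ω)) (h0 : ∀ ω, 0 ≤ h ω) (hhm : Measurable h)
    (hh : Integrable h P) (hfi : ∀ n, Integrable (f n) P)
    (hf : ∀ n ω, f n ω ≤ ∑ k ∈ Finset.range n, h (T^[k] ω)) {q : ℝ}
    (hq : ∀ᵐ ω ∂P, ∃ n : ℕ, 1 ≤ n ∧ f n ω ≤ q * n) {ε : ℝ} (hε : 0 < ε) :
    ∃ K : ℝ, ∀ N : ℕ, ∫ ω, f N ω ∂P ≤ (q + ε) * N + K := by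
  obtain ⟨M, B, hBm, hBε, htile⟩ := exists_tiling hfm hsub h0 hh hf hq hε
  have hψm : Measurable fun ω => h ω + |q| := hhm.add_const _
  have hψi : Integrable (fun ω => h ω + |q|) P := hh.add (integrable_const _)
  have hψ0 : 0 ≤ ∫ ω, (h ω + |q|) ∂P :=
    integral_nonneg fun ω => add_nonneg (h0 ω) (abs_nonneg q)
  refine ⟨M * ∫ ω, (h ω + |q|) ∂P, fun N => ?_⟩
  have hi1 : Integrable (fun ω => ∑ k ∈ Finset.range N,
      B.indicator (fun ω => h ω + |q|) (T^[k] ω)) P :=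
    integrable_finsetSum _ fun k _ => hT.integrable_comp_iterate (hψi.indicator hBm) k
  have hi2 : Integrable (fun ω => ∑ k ∈ Finset.Ico (N - M) N, (h (T^[k] ω) + |q|)) P :=
    integrable_finsetSum _ fun k _ => hT.integrable_comp_iterate hψi k
  have hi3 := (integrable_const (q * N)).fun_add hi1
  have h1 := integral_mono (hfi N) (hi3.fun_add hi2) (htile N)
  rw [integral_add hi3 hi2, integral_add (integrable_const _) hi1,
    integral_finsetSum _ fun k _ => hT.integrable_comp_iterate (hψi.indicator hBm) k,
    integral_finsetSum _ fun k _ => hT.integrable_comp_iterate hψi k] at h1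
  simp_rw [hT.integral_comp_iterate (hψm.indicator hBm), hT.integral_comp_iterate hψm] at h1
  simp only [integral_const, probReal_univ, smul_eq_mul, one_mul, Finset.sum_const,
    Finset.card_range, Nat.card_Ico, nsmul_eq_mul] at h1
  have h2 : ((N - (N - M) : ℕ) : ℝ) ≤ M := by
    exact_mod_cast (by omega : N - (N - M) ≤ M)
  have h3 := mul_le_mul_of_nonneg_right h2 hψ0
  have h4 := mul_le_mul_of_nonneg_left hBε.le (Nat.cast_nonneg (α := ℝ) N)
  linarith

/-- A weak form of the maximal ergodic theorem. -/
theorem not_ae_exists_le_sum (hT : MeasurePreserving T P P) (h0 : ∀ ω, 0 ≤ h ω)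
    (hhm : Measurable h) (hh : Integrable h P) {η : ℝ} (hη : ∫ ω, h ω ∂P < η) :
    ¬ ∀ᵐ ω ∂P, ∃ n : ℕ, 1 ≤ n ∧ η * n ≤ ∑ k ∈ Finset.range n, h (T^[k] ω) := by
  intro hae
  set ε := (η - ∫ ω, h ω ∂P) / 2 with hεdef
  have hε : 0 < ε := by rw [hεdef]; linarith
  -- Negated Birkhoff sums are subadditive with majorant zero. The resulting bound makes `ε * N` at
  -- most `K` for all `N`.
  obtain ⟨K, hK⟩ := exists_integral_le (f := fun n ω => -∑ k ∈ Finset.range n, h (T^[k] ω))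
    (h := fun _ => 0) (q := -η) hT
    (fun n => (Finset.measurable_sum _ fun k _ => hhm.comp (hT.iterate k).measurable).neg)
    (fun m n ω => by
      rw [Finset.sum_range_add]
      simp_rw [← Function.iterate_add_apply, add_comm]
      linarith)
    (fun _ => le_rfl) measurable_const (integrable_const 0)
    (fun n => (integrable_finsetSum _ fun k _ => hT.integrable_comp_iterate hh k).neg)
    (fun n ω => by simpa using Finset.sum_nonneg fun k _ => h0 _)
    (by
      filter_upwards [hae] with ω hω
      obtain ⟨n, hn, h1⟩ := hω
      exact ⟨n, hn, by linarith⟩) hε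
  obtain ⟨N, hN⟩ := exists_nat_gt (K / ε)
  have h1 := hK N
  rw [integral_neg, integral_finsetSum _ fun k _ => hT.integrable_comp_iterate hh k] at h1
  simp_rw [hT.integral_comp_iterate hhm] at h1
  simp only [Finset.sum_const, Finset.card_range, nsmul_eq_mul] at h1
  rw [div_lt_iff₀ hε] at hN
  have h2 : ∫ ω, h ω ∂P = η - 2 * ε := by rw [hεdef]; ring
  rw [h2] at h1
  linarith

theorem eventually_sum_Ico_le {u : ℕ → ℝ} (hu : Tendsto (fun n : ℕ => u n / n) atTop (𝓝 0))
    (M : ℕ) {ε : ℝ} (hε : 0 < ε) :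
    ∀ᶠ N : ℕ in atTop, ∑ k ∈ Finset.Ico (N - M) N, u k ≤ ε * N := by
  have hδ : 0 < ε / (M + 1) := by positivity
  obtain ⟨K, hK⟩ := eventually_atTop.1 (hu.eventually_lt_const hδ)
  -- The threshold makes every index of the window both positive and at least `K`.
  filter_upwards [eventually_ge_atTop (K + 1 + M)] with N hN
  have h1 : ∀ k ∈ Finset.Ico (N - M) N, u k ≤ ε / (M + 1) * N := by
    intro k hk
    rw [Finset.mem_Ico] at hk
    have hk0 : (0 : ℝ) < k := by exact_mod_cast (by omega : 0 < k)
    have h2 := (div_lt_iff₀ hk0).1 (hK k (by omega))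
    refine h2.le.trans (mul_le_mul_of_nonneg_left ?_ hδ.le)
    exact_mod_cast hk.2.le
  refine (Finset.sum_le_card_nsmul _ _ _ h1).trans ?_
  rw [Nat.card_Ico, nsmul_eq_mul, (by omega : N - (N - M) = M)]
  have h3 : (M : ℝ) * (ε / (M + 1) * N) = (M / (M + 1)) * (ε * N) := by ring
  rw [h3]
  refine mul_le_of_le_one_left (by positivity) ?_
  rw [div_le_one (by positivity)]
  linarith

/-- If averages above `η` recurred, the tiling inequality would force the Birkhoff averages of the
cost on the bad set to reach `ε` almost everywhere, although the mean of this cost is below `ε`. -/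
theorem not_ae_frequently_lt (hT : MeasurePreserving T P P) (hfm : ∀ n, Measurable (f n))
    (hsub : ∀ m n ω, f (m + n) ω ≤ f m ω + f n (T^[m] ω)) (h0 : ∀ ω, 0 ≤ h ω) (hhm : Measurable h)
    (hh : Integrable h P) (hhT : ∀ ω, Tendsto (fun n : ℕ => h (T^[n] ω) / n) atTop (𝓝 0))
    (hf : ∀ n ω, f n ω ≤ ∑ k ∈ Finset.range n, h (T^[k] ω)) {q η : ℝ}
    (hq : ∀ᵐ ω ∂P, ∃ n : ℕ, 1 ≤ n ∧ f n ω ≤ q * n) (hη : q < η) :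
    ¬ ∀ᵐ ω ∂P, ∃ᶠ n : ℕ in atTop, η * n < f n ω := by
  intro hae
  set ε := (η - q) / 2 with hεdef
  have hε : 0 < ε := by rw [hεdef]; linarith
  obtain ⟨M, B, hBm, hBε, htile⟩ := exists_tiling hfm hsub h0 hh hf hq hε
  refine not_ae_exists_le_sum hT
    (fun ω => Set.indicator_nonneg (fun ω _ => add_nonneg (h0 ω) (abs_nonneg q)) ω)
    ((hhm.add_const |q|).indicator hBm) ((hh.add (integrable_const |q|)).indicator hBm) hBε ?_
  filter_upwards [hae] with ω hω
  have hu : Tendsto (fun n : ℕ => (h (T^[n] ω) + |q|) / n) atTop (𝓝 0) := by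
    simp_rw [add_div]
    simpa using (hhT ω).add (tendsto_const_div_atTop_nhds_zero_nat |q|)
  obtain ⟨n, h1, h2, h3⟩ :=
    (hω.and_eventually ((eventually_sum_Ico_le hu M hε).and (eventually_ge_atTop 1))).exists
  refine ⟨n, h3, ?_⟩
  have h4 := htile n ω
  have h5 : η * n = q * n + 2 * (ε * n) := by rw [hεdef]; ring
  linarith

/-- `FrequentlyBelow u q` says that `liminf u n / n < q`. -/
def FrequentlyBelow (u : ℕ → ℝ) (q : ℝ) : Prop :=
  ∃ r < q, ∃ᶠ n : ℕ in atTop, u n < r * n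

theorem FrequentlyBelow.mono {u : ℕ → ℝ} {q q' : ℝ} (hu : FrequentlyBelow u q) (hq : q ≤ q') :
    FrequentlyBelow u q' :=
  let ⟨r, hr, h⟩ := hu
  ⟨r, hr.trans_le hq, h⟩

theorem FrequentlyBelow.exists_le {u : ℕ → ℝ} {q : ℝ} (hu : FrequentlyBelow u q) :
    ∃ n : ℕ, 1 ≤ n ∧ u n ≤ q * n := by
  obtain ⟨r, hr, h⟩ := hu
  obtain ⟨n, h1, h2⟩ := (h.and_eventually (eventually_ge_atTop 1)).exists
  exact ⟨n, h2, h1.le.trans (mul_le_mul_of_nonneg_right hr.le (Nat.cast_nonneg n))⟩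

/-- The subadditive ergodic theorem when the lower and upper limits of the averages satisfy a
zero-one law. -/
theorem exists_ae_tendsto_of_subadditive (hT : MeasurePreserving T P P)
    (hfm : ∀ n, Measurable (f n))
    (hsub : ∀ m n ω, f (m + n) ω ≤ f m ω + f n (T^[m] ω)) (h0 : ∀ ω, 0 ≤ h ω) (hhm : Measurable h)
    (hh : Integrable h P) (hhT : ∀ ω, Tendsto (fun n : ℕ => h (T^[n] ω) / n) atTop (𝓝 0))
    (hf : ∀ n ω, |f n ω| ≤ ∑ k ∈ Finset.range n, h (T^[k] ω))
    (hlow : ∀ q, (∀ᵐ ω ∂P, FrequentlyBelow (fun n => f n ω) q) ∨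
      ∀ᵐ ω ∂P, ¬ FrequentlyBelow (fun n => f n ω) q)
    (hupp : ∀ q, (∀ᵐ ω ∂P, FrequentlyBelow (fun n => -f n ω) q) ∨
      ∀ᵐ ω ∂P, ¬ FrequentlyBelow (fun n => -f n ω) q) :
    ∃ c : ℝ, (∀ᵐ ω ∂P, Tendsto (fun n : ℕ => f n ω / n) atTop (𝓝 c)) ∧
      ∀ ε > 0, ∃ K : ℝ, ∀ N : ℕ, ∫ ω, f N ω ∂P ≤ (c + ε) * N + K := by
  have hfi : ∀ n, Integrable (f n) P := fun n =>
    (integrable_finsetSum _ fun k _ => hT.integrable_comp_iterate hh k).mono'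
      (hfm n).aestronglyMeasurable (.of_forall (hf n))
  have hf' : ∀ n ω, f n ω ≤ ∑ k ∈ Finset.range n, h (T^[k] ω) :=
    fun n ω => (le_abs_self _).trans (hf n ω)
  have hmax := not_ae_exists_le_sum hT h0 hhm hh (lt_add_one (∫ ω, h ω ∂P))
  set I := ∫ ω, h ω ∂P
  -- The infimum of `S` will be the almost sure lower limit of the averages; `hmax` shows that `S`
  -- is nonempty and bounded below.
  set S : Set ℝ := {q | ∀ᵐ ω ∂P, FrequentlyBelow (fun n => f n ω) q} with hS
  have hSne : S.Nonempty := by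
    refine ⟨I + 2, (hlow (I + 2)).resolve_right fun hcon => hmax ?_⟩
    filter_upwards [hcon] with ω hω
    have h1 : ∀ᶠ n : ℕ in atTop, (I + 1) * n ≤ f n ω := by
      by_contra h2
      refine hω ⟨I + 1, by linarith, ?_⟩
      simpa [Filter.Frequently, not_lt] using h2
    obtain ⟨n, h2, h3⟩ := (h1.and (eventually_ge_atTop 1)).exists
    exact ⟨n, h3, h2.trans (hf' n ω)⟩
  have hSbdd : BddBelow S := by
    refine ⟨-(I + 1), fun q hq => ?_⟩
    by_contra hlt
    refine hmax ?_
    filter_upwards [hq] with ω hω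
    obtain ⟨n, h1, h2⟩ := (hω.mono (not_le.1 hlt).le).exists_le
    exact ⟨n, h1, by linarith [(neg_abs_le (f n ω)), hf n ω]⟩
  set c := sInf S with hc
  have hSup : ∀ q, c < q → ∀ᵐ ω ∂P, FrequentlyBelow (fun n => f n ω) q := by
    intro q hq
    obtain ⟨q', hq', hlt⟩ := exists_lt_of_csInf_lt hSne hq
    filter_upwards [hq'] with ω hω using hω.mono hlt.le
  -- The levels `c + ε / 3 < c + 2 * ε / 3 < c + ε` leave room for the strict inequalities, and the
  -- zero-one law turns the failure of an almost sure statement into its almost sure negation.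
  have hupper : ∀ ε > 0, ∀ᵐ ω ∂P, ∀ᶠ n : ℕ in atTop, f n ω ≤ (c + ε) * n := by
    intro ε hε
    have h1 : ∀ᵐ ω ∂P, ∃ n : ℕ, 1 ≤ n ∧ f n ω ≤ (c + ε / 3) * n :=
      (hSup (c + ε / 3) (by linarith)).mono fun ω hω => hω.exists_le
    have h2 := not_ae_frequently_lt hT hfm hsub h0 hhm hh hhT hf' h1
      (by linarith : c + ε / 3 < c + 2 * ε / 3)
    have h3 := (hupp (-(c + 2 * ε / 3))).resolve_left fun hcon => h2 <| by
      filter_upwards [hcon] with ω hω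
      obtain ⟨r, hr, hfr⟩ := hω
      refine hfr.mono fun n hn => ?_
      have := mul_le_mul_of_nonneg_right hr.le (Nat.cast_nonneg (α := ℝ) n)
      linarith
    filter_upwards [h3] with ω hω
    by_contra h4
    refine hω ⟨-(c + ε), by linarith, ?_⟩
    rw [Filter.not_eventually] at h4
    refine h4.mono fun n hn => ?_
    linarith [not_le.1 hn]
  have hlower : ∀ ε > 0, ∀ᵐ ω ∂P, ∀ᶠ n : ℕ in atTop, (c - ε) * n ≤ f n ω := by
    intro ε hε
    have h1 : c - ε / 2 ∉ S := fun hmem => by linarith [csInf_le hSbdd hmem]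
    filter_upwards [(hlow (c - ε / 2)).resolve_left h1] with ω hω
    by_contra h4
    refine hω ⟨c - ε, by linarith, ?_⟩
    rw [Filter.not_eventually] at h4
    exact h4.mono fun n hn => not_le.1 hn
  refine ⟨c, ?_, fun ε hε => ?_⟩
  · have h1 : ∀ᵐ ω ∂P, ∀ m : ℕ, ∀ᶠ n : ℕ in atTop, f n ω ≤ (c + 1 / (m + 1 : ℝ)) * n :=
      ae_all_iff.2 fun m => hupper _ (by positivity)
    have h2 : ∀ᵐ ω ∂P, ∀ m : ℕ, ∀ᶠ n : ℕ in atTop, (c - 1 / (m + 1 : ℝ)) * n ≤ f n ω :=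
      ae_all_iff.2 fun m => hlower _ (by positivity)
    filter_upwards [h1, h2] with ω h1 h2
    rw [Metric.tendsto_nhds]
    intro ε hε
    obtain ⟨m, hm⟩ := exists_nat_one_div_lt hε
    filter_upwards [h1 m, h2 m, eventually_ge_atTop 1] with n h3 h4 h5
    have hn : (0 : ℝ) < n := by exact_mod_cast h5
    rw [Real.dist_eq, abs_lt]
    have h6 := (div_le_iff₀ hn).2 h3
    have h7 := (le_div_iff₀ hn).2 h4
    constructor <;> linarith
  · have h1 : ∀ᵐ ω ∂P, ∃ n : ℕ, 1 ≤ n ∧ f n ω ≤ (c + ε / 2) * n :=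
      (hSup (c + ε / 2) (by linarith)).mono fun ω hω => hω.exists_le
    obtain ⟨K, hK⟩ := exists_integral_le hT hfm hsub h0 hhm hh hfi hf' h1 (half_pos hε)
    refine ⟨K, fun N => (hK N).trans (le_of_eq ?_)⟩
    ring

/-- By invariance the event `(m + 1) * h ∘ T^[n] > n` has the probability of `(m + 1) * h > n`.
These are summable since `h` is integrable, and Borel–Cantelli applies for each `m`. -/
theorem ae_tendsto_comp_iterate_div (hT : MeasurePreserving T P P) (h0 : ∀ ω, 0 ≤ h ω)
    (hhm : Measurable h) (hh : Integrable h P) :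
    ∀ᵐ ω ∂P, Tendsto (fun n : ℕ => h (T^[n] ω) / n) atTop (𝓝 0) := by
  have key : ∀ m : ℕ, ∀ᵐ ω ∂P, ∀ᶠ n : ℕ in atTop, (m + 1 : ℝ) * h (T^[n] ω) ≤ n := by
    intro m
    let _ : MeasureSpace Ω := ⟨P⟩
    have hfin := ProbabilityTheory.tsum_prob_mem_Ioi_lt_top
      (X := fun ω => (m + 1 : ℝ) * h ω) (hh.const_mul _)
      (fun ω => mul_nonneg (by positivity) (h0 ω))
    have heq : ∀ n : ℕ, P {ω | (n : ℝ) < (m + 1 : ℝ) * h (T^[n] ω)} =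
        P {ω | (m + 1 : ℝ) * h ω ∈ Set.Ioi (n : ℝ)} := fun n =>
      (hT.iterate n).measure_preimage
        (measurableSet_lt measurable_const (hhm.const_mul _)).nullMeasurableSet
    have hbc := ae_eventually_notMem (μ := P)
      (s := fun n : ℕ => {ω | (n : ℝ) < (m + 1 : ℝ) * h (T^[n] ω)})
      (by simp_rw [heq]; exact hfin.ne)
    filter_upwards [hbc] with ω hω
    exact hω.mono fun n hn => not_lt.1 hn
  filter_upwards [ae_all_iff.2 key] with ω hω
  rw [Metric.tendsto_nhds]
  intro ε hε
  obtain ⟨m, hm⟩ := exists_nat_one_div_lt hε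
  filter_upwards [hω m, eventually_ge_atTop 1] with n h1 h2
  have hn : (0 : ℝ) < n := by exact_mod_cast h2
  rw [Real.dist_eq, sub_zero, abs_of_nonneg (div_nonneg (h0 _) hn.le)]
  refine lt_of_le_of_lt ?_ hm
  rw [div_le_div_iff₀ hn (by positivity)]
  linarith

end Subadditive

/-! ### Positive solutions of systems with ML-matrices -/

section MLMatrix

variable {N : ℕ}

theorem Finset.sum_sum_eq_sum_diag_add_sum_Ioi {N : ℕ} (f : Fin N → Fin N → ℝ) :
    ∑ i, ∑ j, f i j = ∑ i, f i i + ∑ i, ∑ j ∈ Finset.Ioi i, (f i j + f j i) := by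
  have h1 : ∀ i, ∑ j, f i j = f i i + (∑ j ∈ Finset.Ioi i, f i j + ∑ j ∈ Finset.Iio i, f i j) := by
    intro i
    have hu : (Finset.univ : Finset (Fin N)) = insert i (Finset.Ioi i ∪ Finset.Iio i) := by
      ext j
      simp only [Finset.mem_univ, Finset.mem_insert, Finset.mem_union, Finset.mem_Ioi,
        Finset.mem_Iio, true_iff]
      rcases lt_trichotomy i j with h | h | h
      · exact Or.inr (Or.inl h)
      · exact Or.inl h.symm
      · exact Or.inr (Or.inr h)
    rw [hu, Finset.sum_insert (by simp), Finset.sum_union]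
    rw [Finset.disjoint_left]
    intro j hj hj'
    exact lt_asymm (Finset.mem_Ioi.1 hj) (Finset.mem_Iio.1 hj')
  have h2 : ∑ i, ∑ j ∈ Finset.Iio i, f i j = ∑ i, ∑ j ∈ Finset.Ioi i, f j i :=
    Finset.sum_comm' fun i j => by simp
  simp_rw [h1, Finset.sum_add_distrib, h2]

/-- The quantity `tr M + 2 ∑_{j < k} √(M_{jk} M_{kj})`. -/
noncomputable def mlRate (M : Matrix (Fin N) (Fin N) ℝ) : ℝ :=
  M.trace + 2 * ∑ j : Fin N, ∑ k ∈ Finset.Ioi j, √(M j k * M k j)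

theorem two_mul_sqrt_mul_le_add {x y : ℝ} (hx : 0 ≤ x) (hy : 0 ≤ y) : 2 * √(x * y) ≤ x + y := by
  rw [Real.sqrt_mul hx]
  nlinarith [sq_nonneg (√x - √y), Real.sq_sqrt hx, Real.sq_sqrt hy]

/-- For `i < j` the terms `M i j * v j / v i` and `M j i * v i / v j` have product `M i j * M j i`,
whatever `v` is; AM-GM bounds their sum. -/
theorem mlRate_le_sum_mulVec_div {M : Matrix (Fin N) (Fin N) ℝ} (hM : IsMLMatrix M)
    {v : Fin N → ℝ} (hv : ∀ i, 0 < v i) : mlRate M ≤ ∑ i, (M.mulVec v) i / v i := by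
  have h1 : ∑ i, (M.mulVec v) i / v i = ∑ i, ∑ j, M i j * v j / v i :=
    Finset.sum_congr rfl fun i _ => by rw [← Finset.sum_div]; rfl
  rw [h1, Finset.sum_sum_eq_sum_diag_add_sum_Ioi, mlRate, Matrix.trace, Finset.mul_sum]
  refine add_le_add (le_of_eq (Finset.sum_congr rfl fun i _ => ?_))
    (Finset.sum_le_sum fun i _ => ?_)
  · rw [Matrix.diag_apply, mul_div_cancel_right₀ _ (hv i).ne']
  · rw [Finset.mul_sum]
    refine Finset.sum_le_sum fun j hj => ?_
    have hij : i ≠ j := (Finset.mem_Ioi.1 hj).ne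
    have h2 : M i j * M j i = (M i j * v j / v i) * (M j i * v i / v j) := by
      have := (hv i).ne'
      have := (hv j).ne'
      field_simp
    rw [h2]
    exact two_mul_sqrt_mul_le_add
      (div_nonneg (mul_nonneg (hM i j hij) (hv j).le) (hv i).le)
      (div_nonneg (mul_nonneg (hM j i hij.symm) (hv i).le) (hv j).le)

theorem measurable_mlRate {α : Type*} [MeasurableSpace α] {C : α → Matrix (Fin N) (Fin N) ℝ}
    (hC : ∀ i j, Measurable fun a => C a i j) : Measurable fun a => mlRate (C a) := by
  unfold mlRate Matrix.trace
  refine (Finset.measurable_fun_sum _ fun i _ => hC i i).add (Measurable.const_mul ?_ 2)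
  exact Finset.measurable_fun_sum _ fun i _ => Finset.measurable_fun_sum _ fun j _ =>
    ((hC i j).mul (hC j i)).sqrt

theorem abs_mlRate_le {M : Matrix (Fin N) (Fin N) ℝ} (hM : IsMLMatrix M) :
    |mlRate M| ≤ ∑ i, ∑ j, |M i j| := by
  rw [Finset.sum_sum_eq_sum_diag_add_sum_Ioi, mlRate, Matrix.trace, Finset.mul_sum]
  refine (abs_add_le _ _).trans (add_le_add (Finset.abs_sum_le_sum_abs _ _) ?_)
  refine (Finset.abs_sum_le_sum_abs _ _).trans (Finset.sum_le_sum fun i _ => ?_)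
  rw [Finset.mul_sum]
  refine (Finset.abs_sum_le_sum_abs _ _).trans (Finset.sum_le_sum fun j hj => ?_)
  have hij : i ≠ j := (Finset.mem_Ioi.1 hj).ne
  rw [abs_of_nonneg (by positivity), abs_of_nonneg (hM i j hij), abs_of_nonneg (hM j i hij.symm)]
  exact two_mul_sqrt_mul_le_add (hM i j hij) (hM j i hij.symm)

end MLMatrix

/-! ### Positivity of solutions and logarithmic growth. -/

section Positivity

variable {N : ℕ} {C : ℝ → Matrix (Fin N) (Fin N) ℝ} {x : ℝ → EuclideanSpace ℝ (Fin N)}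

theorem IsCaratheodorySolution.absolutelyContinuousOnInterval_apply
    (hx : IsCaratheodorySolution C x) (i : Fin N) (a b : ℝ) :
    AbsolutelyContinuousOnInterval (fun t => x t i) a b :=
  (hx.1 a b).of_dist_le 1 fun s _ t _ => by
    rw [one_mul, dist_eq_norm, dist_eq_norm]
    exact PiLp.norm_apply_le (x s - x t) i

theorem IsCaratheodorySolution.continuous_apply
    (hx : IsCaratheodorySolution C x) (i : Fin N) : Continuous fun t => x t i :=
  continuous_iff_continuousAt.2 fun t =>
    (hx.absolutelyContinuousOnInterval_apply i (t - 1) (t + 1)).continuousOn.continuousAt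
      (by rw [Set.uIcc_of_le (by linarith)]; exact Icc_mem_nhds (by linarith) (by linarith))

theorem IsCaratheodorySolution.ae_hasDerivAt_apply
    (hx : IsCaratheodorySolution C x) :
    ∀ᵐ t, ∀ i, HasDerivAt (fun t => x t i) (((C t).mulVec (x t).ofLp) i) t := by
  filter_upwards [hx.2] with t ht i
  exact (EuclideanSpace.proj (𝕜 := ℝ) i).hasFDerivAt.comp_hasDerivAt t ht

/-- A solution of a system with ML-matrices that starts in the interior of the positive orthant
stays there. -/
theorem IsCaratheodorySolution.apply_pos (hx : IsCaratheodorySolution C x)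
    (hC : ∀ t, IsMLMatrix (C t)) (hCi : ∀ i, LocallyIntegrable fun t => C t i i)
    (hx0 : ∀ i, 0 < x 0 i) {t : ℝ} (ht : 0 ≤ t) (i : Fin N) : 0 < x t i := by
  by_contra hcon
  have hcl : IsCompact (Set.Icc 0 t ∩ ⋃ i, {s | x s i ≤ 0}) :=
    isCompact_Icc.inter_right (isClosed_iUnion_of_finite fun i =>
      isClosed_le (hx.continuous_apply i) continuous_const)
  -- `τ` is the first time at which some coordinate, the `j`-th, fails to be positive.
  obtain ⟨τ, hτ, hmin⟩ := hcl.exists_isLeast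
    ⟨t, ⟨ht, le_rfl⟩, Set.mem_iUnion.2 ⟨i, not_lt.1 hcon⟩⟩
  obtain ⟨j, hj⟩ := Set.mem_iUnion.1 hτ.2
  have hτ0 : 0 ≤ τ := hτ.1.1
  have hpos : ∀ s ∈ Set.Ioo 0 τ, ∀ k, 0 < x s k := by
    intro s hs k
    by_contra hk
    exact absurd (hmin ⟨⟨hs.1.le, hs.2.le.trans hτ.1.2⟩, Set.mem_iUnion.2 ⟨k, not_lt.1 hk⟩⟩)
      (not_le.2 hs.2)
  -- The integrating factor `exp γ` removes the diagonal term, so up to `τ` the derivative of `exp γ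
  -- * x_j` contains only nonnegative off-diagonal contributions.
  set γ : ℝ → ℝ := fun s => -∫ r in 0..s, C r j j with hγ
  have hγc : Continuous γ := ((hCi j).continuous_integral 0).neg
  have hγac : AbsolutelyContinuousOnInterval γ 0 τ :=
    ((hCi j).absolutelyContinuousOnInterval_integral 0 0 τ).neg
  obtain ⟨K, hK⟩ := hγac.exists_bound
  have hexp : AbsolutelyContinuousOnInterval (fun s => Real.exp (γ s)) 0 τ :=
    hγac.comp_contDiffOn (m := -K) (M := K) Real.contDiff_exp.contDiffOn
      fun s hs => abs_le.1 (hK s hs)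
  have hle := (hexp.mul (hx.absolutelyContinuousOnInterval_apply j 0 τ)).le_of_ae_hasDerivAt_nonneg
    (f' := fun s => Real.exp (γ s) * (((C s).mulVec (x s).ofLp) j - C s j j * x s j)) hτ0 (by
      filter_upwards [hx.ae_hasDerivAt_apply, LocallyIntegrable.ae_hasDerivAt_integral (hCi j)]
        with s h1 h2 hs
      constructor
      · refine ((h2 0).neg.exp.mul (h1 j)).congr_deriv ?_
        simp only [hγ, Pi.neg_apply]
        ring
      · refine mul_nonneg (Real.exp_nonneg _) ?_
        rw [Matrix.mulVec, dotProduct, ← Finset.add_sum_erase _ _ (Finset.mem_univ j),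
          add_sub_cancel_left]
        exact Finset.sum_nonneg fun k hk =>
          mul_nonneg (hC s j k (Finset.ne_of_mem_erase hk).symm) (hpos s hs k).le)
  simp only [Pi.mul_apply] at hle
  have h0 : 0 < Real.exp (γ 0) * x 0 j := mul_pos (Real.exp_pos _) (hx0 j)
  exact absurd (h0.trans_le hle) (not_lt.2 (mul_nonpos_of_nonneg_of_nonpos (Real.exp_nonneg _) hj))

/-- Along a positive solution the logarithm of the product of the coordinates grows at least at
the rate `mlRate`. -/
theorem IsCaratheodorySolution.integral_mlRate_le (hx : IsCaratheodorySolution C x)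
    (hC : ∀ t, IsMLMatrix (C t)) (hCi : ∀ i, LocallyIntegrable fun t => C t i i)
    (hrate : LocallyIntegrable fun t => mlRate (C t)) (hx0 : ∀ i, 0 < x 0 i) {t : ℝ} (ht : 0 ≤ t) :
    ∑ i, Real.log (x 0 i) + ∫ s in 0..t, mlRate (C s) ≤ ∑ i, Real.log (x t i) := by
  have hpos : ∀ s ∈ Set.uIcc 0 t, ∀ i, 0 < x s i := fun s hs i =>
    hx.apply_pos hC hCi hx0 (by rw [Set.uIcc_of_le ht] at hs; exact hs.1) i
  have hlog : ∀ i, AbsolutelyContinuousOnInterval (fun s => Real.log (x s i)) 0 t := by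
    intro i
    -- The positive minimum keeps the coordinate in an interval where the logarithm is `C¹`, which
    -- preserves absolute continuity.
    obtain ⟨s₀, hs₀, hmin⟩ := (isCompact_uIcc (a := (0 : ℝ)) (b := t)).exists_isMinOn
      ⟨0, by simp⟩ (hx.continuous_apply i).continuousOn
    obtain ⟨K, hK⟩ := (hx.absolutelyContinuousOnInterval_apply i 0 t).exists_bound
    refine (hx.absolutelyContinuousOnInterval_apply i 0 t).comp_contDiffOn (m := x s₀ i) (M := K)
      ?_ fun s hs => ⟨hmin hs, (le_abs_self _).trans (hK s hs)⟩
    exact contDiffOn_id.log fun r hr => ((hpos s₀ hs₀ i).trans_le hr.1).ne'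
  have hsum : ∀ S : Finset (Fin N),
      AbsolutelyContinuousOnInterval (fun s => ∑ i ∈ S, Real.log (x s i)) 0 t := by
    intro S
    induction S using Finset.cons_induction with
    | empty =>
      simp only [Finset.sum_empty]
      exact contDiffOn_const.absolutelyContinuousOnInterval
    | cons i S hi ih =>
      simp only [Finset.sum_cons]
      exact (hlog i).fun_add ih
  have hle := ((hsum Finset.univ).fun_sub (hrate.absolutelyContinuousOnInterval_integral 0 0 t)
    ).le_of_ae_hasDerivAt_nonneg
    (f' := fun s => ∑ i, ((C s).mulVec (x s).ofLp) i / x s i - mlRate (C s)) ht (by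
      filter_upwards [hx.ae_hasDerivAt_apply, LocallyIntegrable.ae_hasDerivAt_integral hrate]
        with s h1 h2 hs
      have hps := hpos s (by rw [Set.uIcc_of_le ht]; exact Set.Ioo_subset_Icc_self hs)
      exact ⟨(HasDerivAt.fun_sum fun i _ => (h1 i).log (hps i).ne').fun_sub (h2 0),
        sub_nonneg.2 (mlRate_le_sum_mulVec_div (hC s) hps)⟩)
  simp only [intervalIntegral.integral_same, sub_zero] at hle
  linarith

variable [NeZero N] in
-- For the all-ones initial vector the initial logarithms vanish, and each coordinate at time `t` is
-- bounded by the operator norm times the norm of that vector.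
theorem integral_mlRate_le_log_norm
    (hC : ∀ t, IsMLMatrix (C t)) (hCij : ∀ i j, LocallyIntegrable fun t => C t i j)
    (hb : LocallyIntegrable fun t => Matrix.toEuclideanCLM (𝕜 := ℝ) (C t))
    {t : ℝ} (ht : 0 ≤ t) :
    ∫ s in 0..t, mlRate (C s) ≤
      N * (Real.log ‖fundSol (fun t => Matrix.toEuclideanCLM (𝕜 := ℝ) (C t)) t‖ +
        Real.log ‖(WithLp.toLp 2 1 : EuclideanSpace ℝ (Fin N))‖) := by
  set b := fun t => Matrix.toEuclideanCLM (𝕜 := ℝ) (C t)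
  set v : EuclideanSpace ℝ (Fin N) := WithLp.toLp 2 1 with hv
  obtain ⟨hx, hx0⟩ := (isSolutionOperator_fundSol (B := C) hb (.of_forall fun t v => rfl) v _).2 rfl
  have hv1 : ∀ i, v i = 1 := fun i => rfl
  have hpos0 : ∀ i, 0 < fundSol b 0 v i := fun i => by rw [hx0, hv1]; exact one_pos
  have hrate : LocallyIntegrable fun t => mlRate (C t) := by
    have h1 : LocallyIntegrable fun t => ∑ i, ∑ j, |C t i j| := by
      refine locallyIntegrable_finsetSum _ fun i _ => locallyIntegrable_finsetSum _ fun j _ => ?_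
      exact (hCij i j).norm'
    refine h1.mono ?_ (.of_forall fun t => ?_)
    · unfold mlRate Matrix.trace
      refine (Finset.aestronglyMeasurable_fun_sum _ fun i _ => (hCij i i).aestronglyMeasurable).add
        (AEStronglyMeasurable.const_mul ?_ 2)
      refine Finset.aestronglyMeasurable_fun_sum _ fun i _ =>
        Finset.aestronglyMeasurable_fun_sum _ fun j _ => ?_
      exact Real.continuous_sqrt.comp_aestronglyMeasurable
        ((hCij i j).aestronglyMeasurable.mul (hCij j i).aestronglyMeasurable)
    · exact (abs_mlRate_le (hC t)).trans (le_abs_self _)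
  have h1 := hx.integral_mlRate_le hC (fun i => hCij i i) hrate hpos0 ht
  have hvpos : 0 < ‖v‖ := norm_pos_iff.2 fun h => by
    have := hv1 0
    rw [h] at this
    simp at this
  have h2 : ∀ i, Real.log (fundSol b t v i) ≤ Real.log ‖fundSol b t‖ + Real.log ‖v‖ := by
    intro i
    have hp := hx.apply_pos hC (fun i => hCij i i) hpos0 ht i
    have h3 : fundSol b t v i ≤ ‖fundSol b t‖ * ‖v‖ :=
      (le_abs_self _).trans ((PiLp.norm_apply_le (fundSol b t v) i).trans
        ((fundSol b t).le_opNorm v))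
    rw [← Real.log_mul (fun h => by rw [h, zero_mul] at h3; exact absurd h3 (not_le.2 hp))
      hvpos.ne']
    exact Real.log_le_log hp h3
  have h3 := Finset.sum_le_sum fun i (_ : i ∈ Finset.univ) => h2 i
  simp only [Finset.sum_const, Finset.card_univ, Fintype.card_fin, nsmul_eq_mul] at h3
  have h4 : ∑ i, Real.log (fundSol b 0 v i) = 0 :=
    Finset.sum_eq_zero fun i _ => by rw [hx0, hv1, Real.log_one]
  linarith

end Positivity

/-! ### Measurable flows -/

section Flow

variable {Ω : Type*} [MeasurableSpace Ω] {P : Measure Ω} {θ : ℝ → Ω → Ω}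

namespace IsMeasurePreservingDS

variable (hθ : IsMeasurePreservingDS P θ)
include hθ

theorem comp_neg (s : ℝ) (ω : Ω) : θ (-s) (θ s ω) = ω := by
  rw [← hθ.map_add, add_neg_cancel, hθ.map_zero]

theorem comm (s t : ℝ) (ω : Ω) : θ s (θ t ω) = θ t (θ s ω) := by
  rw [← hθ.map_add, add_comm, hθ.map_add]

theorem iterate_one (n : ℕ) (ω : Ω) : (θ 1)^[n] ω = θ n ω := by
  induction n generalizing ω with
  | zero => simp [hθ.map_zero]
  | succ n ih => rw [Function.iterate_succ_apply, ih, ← hθ.map_add, Nat.cast_succ, add_comm]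

theorem isInvariantSet {F : Set Ω} (hF : ∀ s, ∀ ω ∈ F, θ s ω ∈ F) : IsInvariantSet θ F := by
  intro s
  ext ω
  refine ⟨fun h => ?_, hF s ω⟩
  rw [← hθ.comp_neg s ω]
  exact hF (-s) _ h

/-- Every time slice preserves `P`, so Fubini transfers integrability over `Ω` to integrability
along orbits. -/
theorem map_prod [SFinite P] (ν : Measure ℝ) [SFinite ν] :
    (ν.prod P).map (fun p : ℝ × Ω => θ p.1 p.2) = ν Set.univ • P := by
  ext F hF
  rw [Measure.map_apply hθ.measurable hF, Measure.prod_apply (hθ.measurable hF)]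
  have : ∀ t, P (Prod.mk t ⁻¹' ((fun p : ℝ × Ω => θ p.1 p.2) ⁻¹' F)) = P F := fun t =>
    (hθ.measurePreserving t).measure_preimage hF.nullMeasurableSet
  simp_rw [this]
  rw [lintegral_const, Measure.smul_apply, smul_eq_mul, mul_comm]

theorem integrable_prod [SFinite P] {E : Type*} [NormedAddCommGroup E] {φ : Ω → E}
    (hφ : Integrable φ P) (ν : Measure ℝ) [IsFiniteMeasure ν] :
    Integrable (fun p : ℝ × Ω => φ (θ p.1 p.2)) (ν.prod P) := by
  have h1 : Integrable φ ((ν.prod P).map (fun p : ℝ × Ω => θ p.1 p.2)) := by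
    rw [hθ.map_prod]
    exact hφ.smul_measure (measure_ne_top _ _)
  exact h1.comp_measurable hθ.measurable

theorem integrable_integral [SFinite P] {φ : Ω → ℝ} (hφ : Integrable φ P) {t : ℝ} (ht : 0 ≤ t) :
    Integrable (fun ω => ∫ s in 0..t, φ (θ s ω)) P := by
  simp_rw [intervalIntegral.integral_of_le ht]
  exact (hθ.integrable_prod hφ (volume.restrict (Set.Ioc 0 t))).integral_prod_right

theorem integral_integral [SFinite P] {φ : Ω → ℝ} (hφ : Integrable φ P) (hφm : Measurable φ)
    {t : ℝ} (ht : 0 ≤ t) : ∫ ω, (∫ s in 0..t, φ (θ s ω)) ∂P = t * ∫ ω, φ ω ∂P := by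
  simp_rw [intervalIntegral.integral_of_le ht]
  have h1 := hθ.integrable_prod hφ (volume.restrict (Set.Ioc 0 t))
  rw [integral_integral_swap (f := fun ω s => φ (θ s ω)) h1.swap]
  have h2 : ∀ s, ∫ ω, φ (θ s ω) ∂P = ∫ ω, φ ω ∂P := fun s => by
    conv_rhs => rw [← (hθ.measurePreserving s).map_eq]
    exact (integral_map (hθ.measurePreserving s).measurable.aemeasurable
      hφm.aestronglyMeasurable).symm
  simp_rw [h2]
  simp [ht]

theorem lintegral_lintegral [SFinite P] {a : Ω → ℝ≥0∞} (ha : Measurable a) (ν : Measure ℝ)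
    [SFinite ν] : ∫⁻ ω, ∫⁻ s, a (θ s ω) ∂ν ∂P = ν Set.univ * ∫⁻ ω, a ω ∂P := by
  have h1 : Measurable fun p : ℝ × Ω => a (θ p.1 p.2) := ha.comp hθ.measurable
  rw [lintegral_lintegral_swap (f := fun ω s => a (θ s ω)) (h1.comp measurable_swap).aemeasurable]
  have h2 : ∀ s, ∫⁻ ω, a (θ s ω) ∂P = ∫⁻ ω, a ω ∂P := fun s =>
    (hθ.measurePreserving s).lintegral_comp ha
  simp_rw [h2]
  rw [lintegral_const, mul_comm]

theorem measurable_lintegral {a : Ω → ℝ≥0∞} (ha : Measurable a) (ν : Measure ℝ)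
    [SFinite ν] : Measurable fun ω => ∫⁻ s, a (θ s ω) ∂ν :=
  Measurable.lintegral_prod_right'
    ((ha.comp hθ.measurable).comp measurable_swap : Measurable fun p : Ω × ℝ => a (θ p.2 p.1))

end IsMeasurePreservingDS

theorem FrequentlyBelow.measurableSet {Ω : Type*} [MeasurableSpace Ω] {u : ℕ → Ω → ℝ}
    (hu : ∀ n, Measurable (u n)) (q : ℝ) :
    MeasurableSet {ω | FrequentlyBelow (fun n => u n ω) q} := by
  have : {ω | FrequentlyBelow (fun n => u n ω) q} =
      ⋃ r : ℚ, ⋃ _ : (r : ℝ) < q, ⋂ m : ℕ, ⋃ n : ℕ, ⋃ _ : m ≤ n, {ω | u n ω < r * n} := by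
    ext ω
    simp only [Set.mem_ofPred_eq, Set.mem_iUnion, Set.mem_iInter, FrequentlyBelow,
      frequently_atTop]
    constructor
    · rintro ⟨r, hr, h⟩
      obtain ⟨r', h1, h2⟩ := exists_rat_btwn hr
      refine ⟨r', h2, fun m => ?_⟩
      obtain ⟨n, hn, h3⟩ := h m
      exact ⟨n, hn, h3.trans_le (mul_le_mul_of_nonneg_right h1.le (Nat.cast_nonneg n))⟩
    · rintro ⟨r, hr, h⟩
      refine ⟨r, hr, fun m => ?_⟩
      obtain ⟨n, hn, h3⟩ := h m
      exact ⟨n, hn, h3⟩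
  rw [this]
  exact MeasurableSet.iUnion fun r => MeasurableSet.iUnion fun _ => MeasurableSet.iInter fun m =>
    MeasurableSet.iUnion fun n => MeasurableSet.iUnion fun _ =>
      measurableSet_lt (hu n) measurable_const

/-- The integral of `a` over the orbit segment from time `-k` to time `k`. -/
noncomputable def orbitWindow (θ : ℝ → Ω → Ω) (a : Ω → ℝ≥0∞) (k : ℕ) (ω : Ω) : ℝ≥0∞ :=
  ∫⁻ s in Set.Icc (-(k : ℝ)) k, a (θ s ω)

namespace IsMeasurePreservingDS

variable (hθ : IsMeasurePreservingDS P θ)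
include hθ

theorem orbitWindow_le (a : Ω → ℝ≥0∞) {s : ℝ} {k j : ℕ} (hs : |s| ≤ j) (ω : Ω) :
    orbitWindow θ a k (θ s ω) ≤ orbitWindow θ a (k + j) ω := by
  unfold orbitWindow
  rw [← lintegral_indicator measurableSet_Icc, ← lintegral_indicator measurableSet_Icc,
    ← lintegral_add_left_eq_self
      ((Set.Icc (-((k + j : ℕ) : ℝ)) (k + j : ℕ)).indicator fun u => a (θ u ω)) s]
  refine lintegral_mono fun u => ?_
  by_cases hu : u ∈ Set.Icc (-(k : ℝ)) k
  · have hu' : s + u ∈ Set.Icc (-((k + j : ℕ) : ℝ)) (k + j : ℕ) := by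
      rw [abs_le] at hs
      push_cast
      exact ⟨by linarith [hu.1, hs.1], by linarith [hu.2, hs.2]⟩
    rw [Set.indicator_of_mem hu, Set.indicator_of_mem hu', hθ.map_add]
  · rw [Set.indicator_of_notMem hu]
    exact zero_le

/-- The orbits that avoid the null set `Z` for almost all times, and along which `a` is locally
integrable with windows of sublinear growth. -/
theorem exists_good_set [IsProbabilityMeasure P] {a : Ω → ℝ≥0∞} (ha : Measurable a)
    (hai : ∫⁻ ω, a ω ∂P ≠ ∞) {Z : Set Ω} (hZ : MeasurableSet Z) (hPZ : P Z = 0) :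
    ∃ G : Set Ω, MeasurableSet G ∧ IsInvariantSet θ G ∧ P G = 1 ∧ ∀ ω ∈ G,
      (∀ᵐ s : ℝ, θ s ω ∉ Z) ∧ (∀ k, orbitWindow θ a k ω ≠ ∞) ∧
      ∀ k, Tendsto (fun n : ℕ => (orbitWindow θ a k (θ n ω)).toReal / n) atTop (𝓝 0) := by
  have hWm : ∀ k, Measurable (orbitWindow θ a k) := fun k => hθ.measurable_lintegral ha _
  have hind : Measurable (Z.indicator (1 : Ω → ℝ≥0∞)) := measurable_one.indicator hZ
  set G₁ : Set Ω := {ω | ∫⁻ s, Z.indicator 1 (θ s ω) ∂(volume : Measure ℝ) = 0} with hG₁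
  set G₂ : Set Ω := ⋂ k, {ω | orbitWindow θ a k ω ≠ ∞} with hG₂
  set G₃ : Set Ω := ⋂ k,
    {ω | Tendsto (fun n : ℕ => (orbitWindow θ a k (θ n ω)).toReal / n) atTop (𝓝 0)} with hG₃
  have hθm : ∀ s, Measurable (θ s) := fun s => (hθ.measurePreserving s).measurable
  have hm₁ : MeasurableSet G₁ :=
    measurableSet_eq_fun (hθ.measurable_lintegral hind _) measurable_const
  have hm₂ : MeasurableSet G₂ := MeasurableSet.iInter fun k =>
    (measurableSet_eq_fun (hWm k) measurable_const).compl
  have hm₃ : MeasurableSet G₃ := MeasurableSet.iInter fun k =>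
    measurableSet_tendsto _ fun n => (((hWm k).comp (hθm n)).ennreal_toReal.div_const _)
  have hae₁ : ∀ᵐ ω ∂P, ω ∈ G₁ := by
    refine (lintegral_eq_zero_iff (hθ.measurable_lintegral hind _)).1 ?_
    rw [hθ.lintegral_lintegral hind, lintegral_indicator_one hZ, hPZ, mul_zero]
  have hWint : ∀ k, ∫⁻ ω, orbitWindow θ a k ω ∂P ≠ ∞ := fun k => by
    unfold orbitWindow
    rw [hθ.lintegral_lintegral ha]
    exact ENNReal.mul_ne_top (measure_ne_top _ _) hai
  have hae₂ : ∀ᵐ ω ∂P, ω ∈ G₂ := by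
    simp only [hG₂, Set.mem_iInter]
    exact ae_all_iff.2 fun k => (ae_lt_top (hWm k) (hWint k)).mono fun ω h => h.ne
  have hae₃ : ∀ᵐ ω ∂P, ω ∈ G₃ := by
    simp only [hG₃, Set.mem_iInter]
    refine ae_all_iff.2 fun k => ?_
    have := ae_tendsto_comp_iterate_div (hθ.measurePreserving 1)
      (h := fun ω => (orbitWindow θ a k ω).toReal) (fun _ => ENNReal.toReal_nonneg)
      (hWm k).ennreal_toReal
      (integrable_toReal_of_lintegral_ne_top (hWm k).aemeasurable (hWint k))
    simpa only [hθ.iterate_one, Set.mem_ofPred_eq] using this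
  refine ⟨G₁ ∩ G₂ ∩ G₃, (hm₁.inter hm₂).inter hm₃, hθ.isInvariantSet ?_, ?_, ?_⟩
  -- A shift by `s` with `|s| ≤ j` moves a window of radius `k` inside one of radius `k + j`;
  -- requiring the conditions for all radii therefore makes them invariant.
  · rintro s ω ⟨⟨h1, h2⟩, h3⟩
    obtain ⟨j, hj⟩ := exists_nat_ge |s|
    have h2' : ∀ k, orbitWindow θ a k ω ≠ ∞ := fun k => Set.mem_iInter.1 h2 k
    refine ⟨⟨?_, Set.mem_iInter.2 fun k => ?_⟩, Set.mem_iInter.2 fun k => ?_⟩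
    · change ∫⁻ u, Z.indicator 1 (θ u (θ s ω)) ∂(volume : Measure ℝ) = 0
      simp_rw [← hθ.map_add]
      rw [lintegral_add_left_eq_self (fun u => Z.indicator (1 : Ω → ℝ≥0∞) (θ u ω)) s]
      exact h1
    · exact ne_top_of_le_ne_top (h2' _) (hθ.orbitWindow_le a hj ω)
    · refine squeeze_zero (fun n => by positivity) (fun n => ?_) (Set.mem_iInter.1 h3 (k + j))
      refine div_le_div_of_nonneg_right (ENNReal.toReal_mono ?_ ?_) (Nat.cast_nonneg n)
      · exact ne_top_of_le_ne_top (h2' (k + j + n)) (hθ.orbitWindow_le a (by simp) ω)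
      · rw [hθ.comm]
        exact hθ.orbitWindow_le a hj _
  · rw [prob_compl_eq_zero_iff ((hm₁.inter hm₂).inter hm₃) |>.symm]
    filter_upwards [hae₁, hae₂, hae₃] with ω h1 h2 h3 using ⟨⟨h1, h2⟩, h3⟩
  · rintro ω ⟨⟨h1, h2⟩, h3⟩
    refine ⟨?_, fun k => Set.mem_iInter.1 h2 k, fun k => Set.mem_iInter.1 h3 k⟩
    have := (lintegral_eq_zero_iff ((hind.comp hθ.measurable).comp measurable_prodMk_right)).1 h1
    filter_upwards [this] with s hs hsZ
    simp [hsZ] at hs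

/-- The gap between the levels `r < q` absorbs an `o(n)` error, so the event is invariant under
every `θ s` and ergodicity of the flow itself applies. -/
theorem frequentlyBelow_zero_one [IsProbabilityMeasure P] (herg : IsErgodicDS P θ)
    {u : ℕ → Ω → ℝ} (hu : ∀ n, Measurable (u n))
    (hinv : ∀ s ω, ∃ e : ℕ → ℝ, Tendsto (fun n : ℕ => e n / n) atTop (𝓝 0) ∧
      ∀ n, u n (θ s ω) ≤ u n ω + e n) (q : ℝ) :
    (∀ᵐ ω ∂P, FrequentlyBelow (fun n => u n ω) q) ∨
      ∀ᵐ ω ∂P, ¬ FrequentlyBelow (fun n => u n ω) q := by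
  have hm := FrequentlyBelow.measurableSet hu q
  have hset : IsInvariantSet θ {ω | FrequentlyBelow (fun n => u n ω) q} := by
    refine hθ.isInvariantSet ?_
    rintro s ω ⟨r, hr, h⟩
    obtain ⟨e, he, hle⟩ := hinv s ω
    obtain ⟨r', h1, h2⟩ := exists_between hr
    refine ⟨r', h2, ?_⟩
    refine (h.and_eventually ((he.eventually_lt_const (sub_pos.2 h1)).and
      (eventually_ge_atTop 1))).mono fun n hn => ?_
    obtain ⟨h3, h4, h5⟩ := hn
    have hn0 : (0 : ℝ) < n := by exact_mod_cast h5
    rw [div_lt_iff₀ hn0] at h4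
    have := hle n
    linarith
  rcases herg _ hm hset with h | h
  · right
    exact measure_eq_zero_iff_ae_notMem.1 h
  · left
    exact (prob_compl_eq_zero_iff hm).2 h

end IsMeasurePreservingDS

end Flow

/-! ### The cocycle of a random linear system -/

section Cocycle

variable {Ω : Type*} [MeasurableSpace Ω] {P : Measure Ω} {θ : ℝ → Ω → Ω}
  {E : Type*} [NormedAddCommGroup E] [NormedSpace ℝ E]

/-- The solution operator of the random linear system `x' = b (ω · t) x`. -/
noncomputable def randomCocycle (θ : ℝ → Ω → Ω) (b : Ω → E →L[ℝ] E) (ω : Ω) (t : ℝ) : E →L[ℝ] E :=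
  fundSol (fun s => b (θ s ω)) t

variable {b : Ω → E →L[ℝ] E}

theorem stronglyMeasurable_picardTerm (hθ : IsMeasurePreservingDS P θ) (hb : StronglyMeasurable b)
    (k : ℕ) : StronglyMeasurable fun p : ℝ × Ω => picardTerm (fun s => b (θ s p.2)) k p.1 := by
  induction k with
  | zero => exact stronglyMeasurable_const
  | succ k ih =>
    have hint : StronglyMeasurable fun q : (ℝ × Ω) × ℝ =>
        b (θ q.2 q.1.2) * picardTerm (fun s => b (θ s q.1.2)) k q.2 := by
      refine (hb.comp_measurable (hθ.measurable.comp
        (measurable_snd.prodMk (measurable_snd.comp measurable_fst)))).mul ?_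
      exact ih.comp_measurable (measurable_snd.prodMk (measurable_snd.comp measurable_fst))
    -- The interval integral is the difference of two integrals over `Ioc` sets; the indicator of a
    -- measurable region turns each into a parametric integral over the whole line.
    have hset : ∀ u v : ℝ × Ω → ℝ, Measurable u → Measurable v →
        StronglyMeasurable fun p : ℝ × Ω => ∫ s in Set.Ioc (u p) (v p),
          b (θ s p.2) * picardTerm (fun s => b (θ s p.2)) k s := by
      intro u v hu hv
      have hS : MeasurableSet {q : (ℝ × Ω) × ℝ | q.2 ∈ Set.Ioc (u q.1) (v q.1)} :=
        (measurableSet_lt (hu.comp measurable_fst) measurable_snd).inter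
          (measurableSet_le measurable_snd (hv.comp measurable_fst))
      have h1 := (hint.indicator hS).integral_prod_right' (ν := (volume : Measure ℝ))
      simp_rw [← integral_indicator measurableSet_Ioc]
      exact h1
    exact (hset _ _ measurable_const measurable_fst).sub (hset _ _ measurable_fst measurable_const)

theorem abs_integral_norm_le_orbitWindow {α : Type*} {θ : ℝ → α → α} (b : α → E →L[ℝ] E)
    (hfin : ∀ ω k, orbitWindow θ (fun ω => ‖b ω‖ₑ) k ω ≠ ∞)
    (hloc : ∀ ω, LocallyIntegrable fun s => b (θ s ω)) {s t : ℝ} {k : ℕ}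
    (hs : s ∈ Set.Icc (-(k : ℝ)) k) (ht : t ∈ Set.Icc (-(k : ℝ)) k) (ω : α) :
    |∫ u in s..t, ‖b (θ u ω)‖| ≤ (orbitWindow θ (fun ω => ‖b ω‖ₑ) k ω).toReal := by
  rw [intervalIntegral.abs_integral_eq_abs_integral_uIoc,
    integral_norm_eq_lintegral_enorm (hloc ω).aestronglyMeasurable.restrict,
    abs_of_nonneg ENNReal.toReal_nonneg]
  refine ENNReal.toReal_mono (hfin ω k) (lintegral_mono_set ?_)
  exact Set.uIoc_subset_uIcc.trans (Set.uIcc_subset_Icc hs ht)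

variable [CompleteSpace E]

theorem stronglyMeasurable_randomCocycle (hθ : IsMeasurePreservingDS P θ)
    (hb : StronglyMeasurable b) (hloc : ∀ ω, LocallyIntegrable fun s => b (θ s ω)) (t : ℝ) :
    StronglyMeasurable fun ω => randomCocycle θ b ω t := by
  refine stronglyMeasurable_of_tendsto atTop (f := fun (n : ℕ) (ω : Ω) =>
    ∑ k ∈ Finset.range n, picardTerm (fun s => b (θ s ω)) k t) (fun n => ?_)
    (tendsto_pi_nhds.2 fun ω => (hasSum_picardTerm (hloc ω) t).tendsto_sum_nat)
  exact Finset.stronglyMeasurable_fun_sum _ fun k _ =>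
    (stronglyMeasurable_picardTerm hθ hb k).comp_measurable measurable_prodMk_left

theorem log_randomCocycle_add_le [Nontrivial E] (hθ : IsMeasurePreservingDS P θ)
    (hloc : ∀ ω, LocallyIntegrable fun s => b (θ s ω)) (s t : ℝ) (ω : Ω) :
    Real.log ‖randomCocycle θ b ω (t + s)‖ ≤
      Real.log ‖randomCocycle θ b (θ s ω) t‖ + Real.log ‖randomCocycle θ b ω s‖ := by
  have h := log_norm_fundSol_add_le (hloc ω) s t
  have h1 : (fun u => b (θ (u + s) ω)) = fun u => b (θ u (θ s ω)) :=
    funext fun u => by rw [add_comm, hθ.map_add]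
  rwa [h1] at h

/-- A random linear system all of whose orbits are good: its coefficients are locally integrable
along every orbit, with windows of sublinear growth. -/
structure IsTameSystem (P : Measure Ω) (θ : ℝ → Ω → Ω) (b : Ω → E →L[ℝ] E) : Prop where
  stronglyMeasurable : StronglyMeasurable b
  integrable : Integrable b P
  locallyIntegrable : ∀ ω, LocallyIntegrable fun s => b (θ s ω)
  window_ne_top : ∀ ω k, orbitWindow θ (fun ω => ‖b ω‖ₑ) k ω ≠ ∞
  window_tendsto : ∀ ω k, Tendsto
    (fun n : ℕ => (orbitWindow θ (fun ω => ‖b ω‖ₑ) k (θ n ω)).toReal / n) atTop (𝓝 0)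

namespace IsTameSystem

theorem abs_log_le [Nontrivial E] (hb : IsTameSystem P θ b) {s : ℝ} {k : ℕ} (hs : |s| ≤ k) (ω : Ω) :
    |Real.log ‖randomCocycle θ b ω s‖| ≤ (orbitWindow θ (fun ω => ‖b ω‖ₑ) k ω).toReal :=
  (abs_log_norm_fundSol_le (hb.locallyIntegrable ω) s).trans
    (abs_integral_norm_le_orbitWindow b hb.window_ne_top hb.locallyIntegrable
      ⟨by simp, by simp⟩ (abs_le.1 hs) ω)

variable (hb : IsTameSystem P θ b) (hθ : IsMeasurePreservingDS P θ)
include hb hθ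

/-- From `θ s ω`, go back to `ω`, run for time `t`, then go forward by `s`: the two detours cost one
window each. -/
theorem log_shift_le [Nontrivial E] {s : ℝ} {k : ℕ} (hs : |s| ≤ k) (t : ℝ) (ω : Ω) :
    Real.log ‖randomCocycle θ b (θ s ω) t‖ ≤ Real.log ‖randomCocycle θ b ω t‖ +
      ((orbitWindow θ (fun ω => ‖b ω‖ₑ) k (θ t ω)).toReal +
        (orbitWindow θ (fun ω => ‖b ω‖ₑ) k (θ s ω)).toReal) := by
  have h1 := log_randomCocycle_add_le hθ hb.locallyIntegrable (-s) (t + s) (θ s ω)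
  rw [add_neg_cancel_right, hθ.comp_neg, add_comm t s] at h1
  have h2 := log_randomCocycle_add_le hθ hb.locallyIntegrable t s ω
  have h3 := (abs_le.1 (hb.abs_log_le hs (θ t ω))).2
  have h4 := (abs_le.1 (hb.abs_log_le (s := -s) (by rwa [abs_neg]) (θ s ω))).2
  linarith

theorem exists_log_shift [Nontrivial E] (s : ℝ) (ω : Ω) :
    ∃ e : ℕ → ℝ, Tendsto (fun n : ℕ => e n / n) atTop (𝓝 0) ∧ ∀ n : ℕ,
      |Real.log ‖randomCocycle θ b (θ s ω) n‖ - Real.log ‖randomCocycle θ b ω n‖| ≤ e n := by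
  obtain ⟨k, hk⟩ := exists_nat_ge |s|
  set W := fun ω => (orbitWindow θ (fun ω => ‖b ω‖ₑ) k ω).toReal
  refine ⟨fun n => W (θ n ω) + W (θ n (θ s ω)) + (W ω + W (θ s ω)), ?_, fun n => ?_⟩
  · simp_rw [add_div _ (W ω + W (θ s ω)), add_div (W (θ _ _))]
    simpa using ((hb.window_tendsto ω k).add (hb.window_tendsto (θ s ω) k)).add
      (tendsto_const_div_atTop_nhds_zero_nat (W ω + W (θ s ω)))
  · have h1 := hb.log_shift_le hθ hk n ω
    have h2 := hb.log_shift_le hθ (s := -s) (by rwa [abs_neg]) n (θ s ω)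
    rw [hθ.comp_neg] at h2
    have hW : ∀ ω, 0 ≤ W ω := fun ω => ENNReal.toReal_nonneg
    have h3 := hW ω
    have h4 := hW (θ s ω)
    have h5 := hW (θ n ω)
    have h6 := hW (θ n (θ s ω))
    rw [abs_le]
    constructor <;> simp only [W] at * <;> linarith

/-- Between `⌊t⌋` and `t` the logarithm changes by at most a radius-one window around the integer
time, which is sublinear, and `⌊t⌋ / t` tends to one. -/
theorem tendsto_log_of_nat [Nontrivial E] {ω : Ω} {c : ℝ}
    (h : Tendsto (fun n : ℕ => Real.log ‖randomCocycle θ b ω n‖ / n) atTop (𝓝 c)) :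
    Tendsto (fun t : ℝ => Real.log ‖randomCocycle θ b ω t‖ / t) atTop (𝓝 c) := by
  set W := fun ω => (orbitWindow θ (fun ω => ‖b ω‖ₑ) 1 ω).toReal
  have hdist : ∀ t : ℝ, 0 ≤ t →
      |Real.log ‖randomCocycle θ b ω t‖ - Real.log ‖randomCocycle θ b ω (⌊t⌋₊ : ℝ)‖| ≤
        W (θ (⌊t⌋₊ : ℝ) ω) := by
    intro t ht
    set n : ℝ := (⌊t⌋₊ : ℝ)
    have hn1 : n ≤ t := Nat.floor_le ht
    have hn2 : t < n + 1 := Nat.lt_floor_add_one t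
    have h1 := log_randomCocycle_add_le hθ hb.locallyIntegrable n (t - n) ω
    rw [sub_add_cancel] at h1
    have h2 := log_randomCocycle_add_le hθ hb.locallyIntegrable t (n - t) ω
    rw [sub_add_cancel] at h2
    have h3 := (abs_le.1 (hb.abs_log_le (s := t - n) (k := 1)
      (by rw [abs_le]; push_cast; constructor <;> linarith) (θ n ω))).2
    have h4 : Real.log ‖randomCocycle θ b (θ t ω) (n - t)‖ ≤ W (θ n ω) := by
      refine (le_abs_self _).trans ((abs_log_norm_fundSol_le (hb.locallyIntegrable _) _).trans ?_)
      have h5 : ∀ u, θ u (θ t ω) = θ (u + (t - n)) (θ n ω) := fun u => by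
        rw [← hθ.map_add, ← hθ.map_add]
        congr 1
        ring
      simp_rw [h5]
      rw [intervalIntegral.integral_comp_add_right (fun u => ‖b (θ u (θ n ω))‖)]
      refine abs_integral_norm_le_orbitWindow b hb.window_ne_top hb.locallyIntegrable ?_ ?_ _
      all_goals
        push_cast
        constructor <;> linarith
    rw [abs_le]
    constructor <;> simp only [W] at * <;> linarith
  have hfl : Tendsto (fun t : ℝ => ⌊t⌋₊) atTop atTop := tendsto_nat_floor_atTop
  have hr := tendsto_nat_floor_div_atTop (R := ℝ)
  have h1 := (h.comp hfl).mul hr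
  have h2 := ((hb.window_tendsto ω 1).comp hfl).mul hr
  rw [mul_one] at h1
  rw [zero_mul] at h2
  have h3 : Tendsto (fun t : ℝ => (Real.log ‖randomCocycle θ b ω t‖ -
      Real.log ‖randomCocycle θ b ω (⌊t⌋₊ : ℝ)‖) / t) atTop (𝓝 0) := by
    refine squeeze_zero_norm' ?_ h2
    filter_upwards [eventually_ge_atTop (1 : ℝ)] with t ht
    have hn : (0 : ℝ) < (⌊t⌋₊ : ℝ) := by exact_mod_cast Nat.floor_pos.2 ht
    rw [norm_div, Real.norm_eq_abs, Real.norm_of_nonneg (by linarith : (0 : ℝ) ≤ t)]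
    simp only [Function.comp_apply]
    rw [div_mul_div_cancel₀ hn.ne']
    exact div_le_div_of_nonneg_right (hdist t (by linarith)) (by linarith)
  have h4 := h1.add h3
  rw [add_zero] at h4
  refine h4.congr' ?_
  filter_upwards [eventually_ge_atTop (1 : ℝ)] with t ht
  have hn : (0 : ℝ) < (⌊t⌋₊ : ℝ) := by exact_mod_cast Nat.floor_pos.2 ht
  simp only [Function.comp_apply]
  rw [div_mul_div_cancel₀ hn.ne']
  ring

theorem integrable_log [Nontrivial E] [IsProbabilityMeasure P] (n : ℕ) :
    Integrable (fun ω => Real.log ‖randomCocycle θ b ω n‖) P := by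
  refine (hθ.integrable_integral hb.integrable.norm (Nat.cast_nonneg n)).mono'
    (stronglyMeasurable_randomCocycle hθ hb.stronglyMeasurable hb.locallyIntegrable
      n).norm.measurable.log.aestronglyMeasurable (.of_forall fun ω => ?_)
  rw [← abs_of_nonneg (intervalIntegral.integral_nonneg (Nat.cast_nonneg n)
    fun u _ => norm_nonneg (b (θ u ω)))]
  exact abs_log_norm_fundSol_le (hb.locallyIntegrable ω) n

/-- Existence of the top Lyapunov exponent of a tame system. -/
theorem exists_exponent [Nontrivial E] [IsProbabilityMeasure P] (herg : IsErgodicDS P θ) :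
    ∃ c : ℝ,
      (∀ᵐ ω ∂P, Tendsto (fun n : ℕ => Real.log ‖randomCocycle θ b ω n‖ / n) atTop (𝓝 c)) ∧
      ∀ ε > 0, ∃ K : ℝ, ∀ n : ℕ, ∫ ω, Real.log ‖randomCocycle θ b ω n‖ ∂P ≤ (c + ε) * n + K := by
  have hfm : ∀ n : ℕ, Measurable fun ω => Real.log ‖randomCocycle θ b ω n‖ := fun n =>
    (stronglyMeasurable_randomCocycle hθ hb.stronglyMeasurable hb.locallyIntegrable
      n).norm.measurable.log
  have hii : ∀ ω s t, IntervalIntegrable (fun u => ‖b (θ u ω)‖) volume s t :=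
    fun ω => (hb.locallyIntegrable ω).norm'.intervalIntegrable'
  have hshift : ∀ (n : ℕ) ω, ∫ u in (0 : ℝ)..1, ‖b (θ u ((θ 1)^[n] ω))‖ =
      ∫ u in (n : ℝ)..(n + 1 : ℕ), ‖b (θ u ω)‖ := fun n ω => by
    have h1 : ∀ u, θ u ((θ 1)^[n] ω) = θ (u + n) ω := fun u => by
      rw [hθ.iterate_one, ← hθ.map_add, add_comm]
    simp_rw [h1]
    rw [intervalIntegral.integral_comp_add_right (fun u => ‖b (θ u ω)‖), zero_add]
    push_cast
    rw [add_comm]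
  -- The majorant `h` is the integral of `‖b‖` over unit time; its Birkhoff sums are integrals over
  -- `[0, n]`, which bound `|log ‖U(n)‖|`.
  refine exists_ae_tendsto_of_subadditive (T := θ 1)
    (f := fun n ω => Real.log ‖randomCocycle θ b ω n‖)
    (h := fun ω => ∫ u in (0 : ℝ)..1, ‖b (θ u ω)‖) (hθ.measurePreserving 1) hfm ?_ ?_ ?_ ?_ ?_ ?_
    ?_ ?_
  · intro m n ω
    have := log_randomCocycle_add_le hθ hb.locallyIntegrable m n ω
    rw [hθ.iterate_one, Nat.cast_add, add_comm (m : ℝ)]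
    linarith
  · exact fun ω => intervalIntegral.integral_nonneg zero_le_one fun _ _ => norm_nonneg _
  · simp_rw [intervalIntegral.integral_of_le zero_le_one]
    exact ((hb.stronglyMeasurable.comp_measurable
      (hθ.measurable.comp measurable_swap)).norm.integral_prod_right').measurable
  · exact hθ.integrable_integral hb.integrable.norm zero_le_one
  · intro ω
    refine squeeze_zero (fun n => div_nonneg (intervalIntegral.integral_nonneg zero_le_one
      fun _ _ => norm_nonneg _) (Nat.cast_nonneg n)) (fun n => ?_) (hb.window_tendsto ω 1)
    refine div_le_div_of_nonneg_right ?_ (Nat.cast_nonneg n)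
    rw [hθ.iterate_one]
    exact (le_abs_self _).trans (abs_integral_norm_le_orbitWindow b hb.window_ne_top
      hb.locallyIntegrable (by simp) (by simp) _)
  · intro n ω
    simp_rw [hshift]
    have h1 := intervalIntegral.sum_integral_adjacent_intervals (μ := volume)
      (f := fun u => ‖b (θ u ω)‖) (a := fun k : ℕ => (k : ℝ)) (n := n) fun k _ => hii ω _ _
    rw [h1, Nat.cast_zero, ← abs_of_nonneg (intervalIntegral.integral_nonneg (Nat.cast_nonneg n)
      fun u _ => norm_nonneg (b (θ u ω)))]
    exact abs_log_norm_fundSol_le (hb.locallyIntegrable ω) n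
  · refine hθ.frequentlyBelow_zero_one herg hfm fun s ω => ?_
    obtain ⟨e, he, h1⟩ := hb.exists_log_shift hθ s ω
    exact ⟨e, he, fun n => by linarith [(abs_le.1 (h1 n)).2]⟩
  · refine hθ.frequentlyBelow_zero_one herg (fun n => (hfm n).neg) fun s ω => ?_
    obtain ⟨e, he, h1⟩ := hb.exists_log_shift hθ s ω
    exact ⟨e, he, fun n => by linarith [(abs_le.1 (h1 n)).1]⟩

end IsTameSystem

end Cocycle

/-! ### Reduction to tame systems. -/

section GoodSet

variable {Ω : Type*} [MeasurableSpace Ω] {P : Measure Ω} {θ : ℝ → Ω → Ω}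
  {E : Type*} [NormedAddCommGroup E] [NormedSpace ℝ E]

/-- Killing the coefficients off an invariant set of good orbits makes a system tame. -/
theorem IsTameSystem.indicator (hθ : IsMeasurePreservingDS P θ) {b : Ω → E →L[ℝ] E}
    (hbm : StronglyMeasurable b) (hbi : Integrable b P) {G : Set Ω} (hG : MeasurableSet G)
    (hinv : IsInvariantSet θ G)
    (hfin : ∀ ω ∈ G, ∀ k, orbitWindow θ (fun ω => ‖b ω‖ₑ) k ω ≠ ∞)
    (hlim : ∀ ω ∈ G, ∀ k, Tendsto
      (fun n : ℕ => (orbitWindow θ (fun ω => ‖b ω‖ₑ) k (θ n ω)).toReal / n) atTop (𝓝 0)) :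
    IsTameSystem P θ (G.indicator b) := by
  have hmem : ∀ s ω, θ s ω ∈ G ↔ ω ∈ G := fun s ω => by
    conv_rhs => rw [← hinv s]
    rfl
  have hin : ∀ ω ∈ G, ∀ k, orbitWindow θ (fun ω => ‖G.indicator b ω‖ₑ) k ω =
      orbitWindow θ (fun ω => ‖b ω‖ₑ) k ω := fun ω hω k => by
    unfold orbitWindow
    simp_rw [Set.indicator_of_mem ((hmem _ ω).2 hω)]
  have hout : ∀ ω ∉ G, ∀ k, orbitWindow θ (fun ω => ‖G.indicator b ω‖ₑ) k ω = 0 :=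
    fun ω hω k => by
      unfold orbitWindow
      simp_rw [Set.indicator_of_notMem (mt (hmem _ ω).1 hω)]
      exact (lintegral_congr fun _ => enorm_zero (E := E →L[ℝ] E)).trans lintegral_zero
  have hfin' : ∀ ω k, orbitWindow θ (fun ω => ‖G.indicator b ω‖ₑ) k ω ≠ ∞ := fun ω k => by
    by_cases hω : ω ∈ G
    · rw [hin ω hω]
      exact hfin ω hω k
    · rw [hout ω hω]
      exact ENNReal.zero_ne_top
  refine ⟨hbm.indicator hG, hbi.mono (hbm.indicator hG).aestronglyMeasurable
    (.of_forall fun ω => norm_indicator_le_norm_self b ω), fun ω => ?_, hfin', fun ω k => ?_⟩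
  · refine locallyIntegrable_iff.2 fun S hS => ?_
    obtain ⟨r, hr⟩ := hS.isBounded.subset_closedBall 0
    obtain ⟨k, hk⟩ := exists_nat_ge r
    have hsub : S ⊆ Set.Icc (-(k : ℝ)) k := fun s hs => by
      have := hr hs
      rw [mem_closedBall_zero_iff, Real.norm_eq_abs] at this
      exact abs_le.1 (this.trans hk)
    refine IntegrableOn.mono_set ⟨?_, (hfin' ω k).lt_top⟩ hsub
    exact ((hbm.indicator hG).comp_measurable
      (hθ.measurable.comp measurable_prodMk_right)).aestronglyMeasurable
  · by_cases hω : ω ∈ G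
    · simp_rw [hin _ ((hmem _ ω).2 hω)]
      exact hlim ω hω k
    · simp_rw [hout _ (mt (hmem _ ω).1 hω)]
      simp

end GoodSet

/-! ### Random matrices and the exponent. -/

section Matrix

variable {Ω : Type*} [MeasurableSpace Ω] {P : Measure Ω} {N : ℕ}

theorem Matrix.toEuclideanCLM_eq_sum (M : Matrix (Fin N) (Fin N) ℝ) :
    Matrix.toEuclideanCLM (𝕜 := ℝ) M =
      ∑ i, ∑ j, M i j • Matrix.toEuclideanCLM (𝕜 := ℝ) (Matrix.single i j (1 : ℝ)) := by
  conv_lhs => rw [Matrix.matrix_eq_sum_single M]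
  simp_rw [map_sum, ← map_smul, Matrix.smul_single, smul_eq_mul, mul_one]

theorem stronglyMeasurable_toEuclideanCLM {C : Ω → Matrix (Fin N) (Fin N) ℝ}
    (hC : ∀ i j, Measurable fun ω => C ω i j) :
    StronglyMeasurable fun ω => Matrix.toEuclideanCLM (𝕜 := ℝ) (C ω) := by
  simp_rw [fun ω => Matrix.toEuclideanCLM_eq_sum (C ω)]
  exact Finset.stronglyMeasurable_fun_sum _ fun i _ => Finset.stronglyMeasurable_fun_sum _
    fun j _ => (hC i j).stronglyMeasurable.smul_const _

theorem integrable_toEuclideanCLM {C : Ω → Matrix (Fin N) (Fin N) ℝ}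
    (hCm : ∀ i j, Measurable fun ω => C ω i j) (hC : ∀ i j, Integrable (fun ω => C ω i j) P) :
    Integrable (fun ω => Matrix.toEuclideanCLM (𝕜 := ℝ) (C ω)) P := by
  refine Integrable.mono' (g := fun ω => ∑ i, ∑ j,
      |C ω i j| * ‖Matrix.toEuclideanCLM (𝕜 := ℝ) (Matrix.single i j (1 : ℝ))‖) ?_
    (stronglyMeasurable_toEuclideanCLM hCm).aestronglyMeasurable (.of_forall fun ω => ?_)
  · exact integrable_finsetSum _ fun i _ => integrable_finsetSum _ fun j _ =>
      (hC i j).abs.mul_const _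
  · rw [Matrix.toEuclideanCLM_eq_sum]
    refine (norm_sum_le _ _).trans (Finset.sum_le_sum fun i _ => ?_)
    refine (norm_sum_le _ _).trans (Finset.sum_le_sum fun j _ => ?_)
    rw [norm_smul, Real.norm_eq_abs]

theorem locallyIntegrable_apply_of_toEuclideanCLM {C : ℝ → Matrix (Fin N) (Fin N) ℝ}
    (hC : LocallyIntegrable fun t => Matrix.toEuclideanCLM (𝕜 := ℝ) (C t)) (i j : Fin N) :
    LocallyIntegrable fun t => C t i j := by
  have hentry : ∀ t, C t i j = EuclideanSpace.proj (𝕜 := ℝ) i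
      (Matrix.toEuclideanCLM (𝕜 := ℝ) (C t) (EuclideanSpace.single j (1 : ℝ))) := fun t => by
    change C t i j = ((C t).mulVec (Pi.single j 1)) i
    simp
  have h1 : LocallyIntegrable fun t =>
      Matrix.toEuclideanCLM (𝕜 := ℝ) (C t) (EuclideanSpace.single j (1 : ℝ)) :=
    hC.clm_apply_continuous continuous_const
  simp_rw [hentry]
  exact h1.mono ((EuclideanSpace.proj (𝕜 := ℝ) i).continuous.comp_aestronglyMeasurable
    h1.aestronglyMeasurable) (.of_forall fun t => PiLp.norm_apply_le
      (Matrix.toEuclideanCLM (𝕜 := ℝ) (C t) (EuclideanSpace.single j (1 : ℝ))) i)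

theorem integrable_mlRate {A : Ω → Matrix (Fin N) (Fin N) ℝ}
    (hA0 : ∀ i j, Integrable (fun ω => A ω i j) P) (hA1 : ∀ ω, IsMLMatrix (A ω)) :
    Integrable (fun ω => mlRate (A ω)) P := by
  refine (integrable_finsetSum _ fun i _ => integrable_finsetSum _ fun j _ =>
    (hA0 i j).abs).mono' ?_ (.of_forall fun ω => abs_mlRate_le (hA1 ω))
  unfold mlRate Matrix.trace
  refine (Finset.aestronglyMeasurable_fun_sum _ fun i _ => (hA0 i i).aestronglyMeasurable).add
    (AEStronglyMeasurable.const_mul ?_ 2)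
  refine Finset.aestronglyMeasurable_fun_sum _ fun i _ =>
    Finset.aestronglyMeasurable_fun_sum _ fun j _ => ?_
  exact Real.continuous_sqrt.comp_aestronglyMeasurable
    ((hA0 i j).aestronglyMeasurable.mul (hA0 j i).aestronglyMeasurable)

/-- A random matrix with integrable entries agrees off a measurable null set with one whose entries
are measurable. -/
theorem exists_null_set_indicator_measurable {A : Ω → Matrix (Fin N) (Fin N) ℝ}
    (hA0 : ∀ i j, Integrable (fun ω => A ω i j) P) :
    ∃ Z : Set Ω, MeasurableSet Z ∧ P Z = 0 ∧ ∀ i j, Measurable fun ω => Zᶜ.indicator A ω i j := by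
  have hae : ∀ᵐ ω ∂P, ∀ i j, A ω i j = (hA0 i j).aestronglyMeasurable.mk _ ω :=
    ae_all_iff.2 fun i => ae_all_iff.2 fun j => (hA0 i j).aestronglyMeasurable.ae_eq_mk
  obtain ⟨Z, hsub, hZ, hPZ⟩ := exists_measurable_superset_of_null (ae_iff.1 hae)
  refine ⟨Z, hZ, hPZ, fun i j => ?_⟩
  have : (fun ω => Zᶜ.indicator A ω i j) =
      Zᶜ.indicator ((hA0 i j).aestronglyMeasurable.mk _) := by
    funext ω
    by_cases hω : ω ∈ Z
    · simp [hω]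
    · have h1 : ∀ i j, A ω i j = (hA0 i j).aestronglyMeasurable.mk _ ω := by
        by_contra hcon
        exact hω (hsub hcon)
      rw [Set.indicator_of_mem (by exact hω), Set.indicator_of_mem (by exact hω), h1]
  rw [this]
  exact (hA0 i j).aestronglyMeasurable.stronglyMeasurable_mk.measurable.indicator hZ.compl

theorem IsMLMatrix.indicator {α : Type*} {A : α → Matrix (Fin N) (Fin N) ℝ}
    (hA : ∀ ω, IsMLMatrix (A ω)) (S : Set α) (ω : α) : IsMLMatrix (S.indicator A ω) := by
  by_cases hω : ω ∈ S
  · rw [Set.indicator_of_mem hω]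
    exact hA ω
  · rw [Set.indicator_of_notMem hω]
    exact fun _ _ _ => le_rfl

variable {θ : ℝ → Ω → Ω}

/-- The lower estimate of the exponent of a tame system with ML-matrices. -/
theorem integral_mlRate_le_mul_exponent [NeZero N] [IsProbabilityMeasure P]
    (hθ : IsMeasurePreservingDS P θ) {B : Ω → Matrix (Fin N) (Fin N) ℝ}
    (hB0 : ∀ i j, Integrable (fun ω => B ω i j) P) (hBm : ∀ i j, Measurable fun ω => B ω i j)
    (hB1 : ∀ ω, IsMLMatrix (B ω))
    (hb : IsTameSystem P θ fun ω => Matrix.toEuclideanCLM (𝕜 := ℝ) (B ω)) {c : ℝ}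
    (hc : ∀ ε > 0, ∃ K : ℝ, ∀ n : ℕ, ∫ ω, Real.log
      ‖randomCocycle θ (fun ω => Matrix.toEuclideanCLM (𝕜 := ℝ) (B ω)) ω n‖ ∂P ≤
        (c + ε) * n + K) :
    ∫ ω, mlRate (B ω) ∂P ≤ N * c := by
  have hN : (0 : ℝ) < N := by exact_mod_cast NeZero.pos N
  refine le_of_forall_pos_le_add fun ε hε => ?_
  obtain ⟨K, hK⟩ := hc (ε / N) (by positivity)
  set L := Real.log ‖(WithLp.toLp 2 1 : EuclideanSpace ℝ (Fin N))‖
  have hi := integrable_mlRate hB0 hB1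
  -- Invariance of `P` makes the expected orbit integral equal to `n` times the mean of `mlRate`. A
  -- positive excess over `N * c + ε` would then grow linearly against a fixed bound.
  have hn : ∀ n : ℕ, n * (∫ ω, mlRate (B ω) ∂P - (N * c + ε)) ≤ N * (K + L) := by
    intro n
    have h1 := integral_mono (hθ.integrable_integral hi (Nat.cast_nonneg n))
      (((hb.integrable_log hθ n).add (integrable_const L)).const_mul (N : ℝ)) fun ω =>
        integral_mlRate_le_log_norm (C := fun s => B (θ s ω)) (fun s => hB1 _)
          (locallyIntegrable_apply_of_toEuclideanCLM (hb.locallyIntegrable ω))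
          (hb.locallyIntegrable ω) (Nat.cast_nonneg n)
    rw [hθ.integral_integral hi (measurable_mlRate hBm) (Nat.cast_nonneg n),
      integral_const_mul, integral_add' (hb.integrable_log hθ n) (integrable_const L)] at h1
    simp only [integral_const, probReal_univ, smul_eq_mul, one_mul] at h1
    have h2 := mul_le_mul_of_nonneg_left (hK n) hN.le
    have h3 : N * ((c + ε / N) * n + K) = n * (N * c + ε) + N * K := by
      field_simp
    linarith
  by_contra hcon
  have hpos : 0 < ∫ ω, mlRate (B ω) ∂P - (N * c + ε) := by linarith [not_le.1 hcon]
  obtain ⟨n, hn'⟩ := exists_nat_gt (N * (K + L) / (∫ ω, mlRate (B ω) ∂P - (N * c + ε)))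
  rw [div_lt_iff₀ hpos] at hn'
  exact absurd (hn n) (not_le.2 hn')

/-- Two sets of full measure share a point, where the solution operators, and hence the limits,
coincide. This carries the estimate over to every exponent. -/
theorem IsTopLyapunovExponent.unique [IsProbabilityMeasure P]
    {A : Ω → Matrix (Fin N) (Fin N) ℝ} {lam lam' : ℝ} (h : IsTopLyapunovExponent P θ A lam)
    (h' : IsTopLyapunovExponent P θ A lam') : lam = lam' := by
  obtain ⟨S, hS, -, hPS, hlim⟩ := h
  obtain ⟨S', hS', -, hPS', hlim'⟩ := h'
  have h1 : ∀ᵐ ω ∂P, ω ∈ S := (prob_compl_eq_zero_iff hS).2 hPS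
  have h2 : ∀ᵐ ω ∂P, ω ∈ S' := (prob_compl_eq_zero_iff hS').2 hPS'
  obtain ⟨ω, hω, hω'⟩ := (h1.and h2).exists
  obtain ⟨U, hU, hlimU⟩ := hlim ω hω
  obtain ⟨U', hU', hlimU'⟩ := hlim' ω hω'
  rw [hU.unique hU'] at hlimU
  exact tendsto_nhds_unique hlimU hlimU'

theorem exists_isTopLyapunovExponent_ge [NeZero N] [IsProbabilityMeasure P]
    (hθ : IsMeasurePreservingDS P θ) (herg : IsErgodicDS P θ)
    {A : Ω → Matrix (Fin N) (Fin N) ℝ} (hA0 : ∀ i j, Integrable (fun ω => A ω i j) P)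
    (hA1 : ∀ ω, IsMLMatrix (A ω)) :
    ∃ lam : ℝ, IsTopLyapunovExponent P θ A lam ∧ ∫ ω, mlRate (A ω) ∂P ≤ N * lam := by
  obtain ⟨Z, hZ, hPZ, hA₁m⟩ := exists_null_set_indicator_measurable hA0
  set A₁ := Zᶜ.indicator A with hA₁
  have hZae : ∀ᵐ ω ∂P, ω ∉ Z := measure_eq_zero_iff_ae_notMem.1 hPZ
  have hA₁i : ∀ i j, Integrable (fun ω => A₁ ω i j) P := fun i j => (hA0 i j).congr <| by
    filter_upwards [hZae] with ω hω
    rw [hA₁, Set.indicator_of_mem (by exact hω)]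
  have hbm := stronglyMeasurable_toEuclideanCLM hA₁m
  have hbi := integrable_toEuclideanCLM hA₁m hA₁i
  obtain ⟨G, hG, hinv, hPG, hgood⟩ := hθ.exists_good_set (a := fun ω =>
    ‖Matrix.toEuclideanCLM (𝕜 := ℝ) (A₁ ω)‖ₑ) hbm.enorm hbi.2.ne hZ hPZ
  -- Two modifications are combined: `A₁` has measurable entries, and `B` vanishes off the good
  -- orbits, so every orbit of `B` is tame.
  set B := G.indicator A₁ with hBdef
  have hGae : ∀ᵐ ω ∂P, ω ∈ G := (prob_compl_eq_zero_iff hG).2 hPG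
  have hBA : ∀ᵐ ω ∂P, B ω = A ω := by
    filter_upwards [hZae, hGae] with ω h1 h2
    rw [hBdef, Set.indicator_of_mem h2, hA₁, Set.indicator_of_mem (by exact h1)]
  have hBij : ∀ i j, (fun ω => B ω i j) = G.indicator fun ω => A₁ ω i j := fun i j => by
    funext ω
    by_cases hω : ω ∈ G <;> simp [hBdef, hω]
  have hBm : ∀ i j, Measurable fun ω => B ω i j := fun i j => by
    rw [hBij]
    exact (hA₁m i j).indicator hG
  have hBi : ∀ i j, Integrable (fun ω => B ω i j) P := fun i j => by
    rw [hBij]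
    exact (hA₁i i j).indicator hG
  have hbB : (fun ω => Matrix.toEuclideanCLM (𝕜 := ℝ) (B ω)) =
      G.indicator fun ω => Matrix.toEuclideanCLM (𝕜 := ℝ) (A₁ ω) := by
    funext ω
    by_cases hω : ω ∈ G <;> simp [hBdef, hω]
  have htame : IsTameSystem P θ fun ω => Matrix.toEuclideanCLM (𝕜 := ℝ) (B ω) := by
    rw [hbB]
    exact IsTameSystem.indicator hθ hbm hbi hG hinv (fun ω hω => (hgood ω hω).2.1)
      fun ω hω => (hgood ω hω).2.2
  obtain ⟨c, hc, hcE⟩ := htame.exists_exponent hθ herg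
  set b := fun ω => Matrix.toEuclideanCLM (𝕜 := ℝ) (B ω) with hbdef
  have hΩ₁ : MeasurableSet (G ∩ {ω | Tendsto
      (fun n : ℕ => Real.log ‖randomCocycle θ b ω n‖ / n) atTop (𝓝 c)}) :=
    hG.inter (measurableSet_tendsto _ fun n : ℕ => (stronglyMeasurable_randomCocycle hθ
      htame.stronglyMeasurable htame.locallyIntegrable n).norm.measurable.log.div_const _)
  refine ⟨c, ⟨G ∩ {ω | Tendsto (fun n : ℕ => Real.log ‖randomCocycle θ b ω n‖ / n) atTop (𝓝 c)},
    hΩ₁, hθ.isInvariantSet ?_, ?_, ?_⟩, ?_⟩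
  · rintro s ω ⟨hω, hlim⟩
    refine ⟨by rw [← hinv s] at hω; exact hω, ?_⟩
    obtain ⟨e, he, hle⟩ := htame.exists_log_shift hθ s ω
    have h1 : Tendsto (fun n : ℕ => (Real.log ‖randomCocycle θ b (θ s ω) n‖ -
        Real.log ‖randomCocycle θ b ω n‖) / n) atTop (𝓝 0) := by
      refine squeeze_zero_norm (fun n => ?_) he
      rw [norm_div, Real.norm_eq_abs, RCLike.norm_natCast]
      exact div_le_div_of_nonneg_right (hle n) (Nat.cast_nonneg n)
    have h2 := Tendsto.add hlim h1
    rw [add_zero] at h2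
    refine h2.congr fun n => ?_
    ring
  · refine (prob_compl_eq_zero_iff hΩ₁).1 ?_
    filter_upwards [hGae, hc] with ω h1 h2 using ⟨h1, h2⟩
  · rintro ω ⟨hω, hlim⟩
    refine ⟨randomCocycle θ b ω, ?_, htame.tendsto_log_of_nat hθ hlim⟩
    refine isSolutionOperator_fundSol (htame.locallyIntegrable ω) ?_
    -- A good orbit avoids `Z` at almost every time, so `B` and `A` define the same Carathéodory
    -- problem along it.
    filter_upwards [(hgood ω hω).1] with s hs v
    have h1 : θ s ω ∈ G := by rw [← hinv s] at hω; exact hω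
    have h2 : B (θ s ω) = A (θ s ω) := by
      rw [hBdef, Set.indicator_of_mem h1, hA₁, Set.indicator_of_mem (by exact hs)]
    rw [hbdef]
    simp only [h2]
    rfl
  · rw [← integral_congr_ae (hBA.mono fun ω h => congrArg mlRate h)]
    exact integral_mlRate_le_mul_exponent hθ hBi hBm
      (IsMLMatrix.indicator (IsMLMatrix.indicator hA1 _) _) htame hcE

end Matrix

theorem mainTheorem1 {Ω : Type*} [MeasurableSpace Ω] (P : Measure Ω) [IsProbabilityMeasure P]
    (θ : ℝ → Ω → Ω) (hθ : IsMeasurePreservingDS P θ) (herg : IsErgodicDS P θ)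
    (N : ℕ) (hN : 1 ≤ N) (A : Ω → Matrix (Fin N) (Fin N) ℝ)
    (hA0 : ∀ i j, Integrable (fun ω => A ω i j) P)
    (hA1 : ∀ ω, IsMLMatrix (A ω)) :
    (∃ lam : ℝ, IsTopLyapunovExponent P θ A lam) ∧
    Integrable (fun ω => (A ω).trace +
      2 * ∑ j : Fin N, ∑ k ∈ Finset.Ioi j, √(A ω j k * A ω k j)) P ∧
    ∀ lam : ℝ, IsTopLyapunovExponent P θ A lam →
      lam ≥ (1 / (N : ℝ)) * ∫ ω, ((A ω).trace +
        2 * ∑ j : Fin N, ∑ k ∈ Finset.Ioi j, √(A ω j k * A ω k j)) ∂P := by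
  have : NeZero N := ⟨by omega⟩
  obtain ⟨c, hc, hle⟩ := exists_isTopLyapunovExponent_ge hθ herg hA0 hA1
  refine ⟨⟨c, hc⟩, integrable_mlRate hA0 hA1, fun lam hlam => ?_⟩
  have hN0 : (0 : ℝ) < N := by exact_mod_cast hN
  rw [hlam.unique hc, ge_iff_le, one_div, inv_mul_le_iff₀ hN0]
  exact hle
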